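/- Let $n\ge 2$, let $(R,\mathfrak m)$ be an $n$-dimensional Cohen–Macaulay local ring, let $x_1,\dots,x_n$ be a system of parameters of $R$ and $Q=(x_1,\dots,x_n)R$. Let $$0\to F_n\xrightarrow{\varphi_n}F_{n-1}\to\cdots\to F_1\xrightarrow{\varphi_1}F_0$$ be an acyclic complex of finitely generated free $R$-modules (exact in all positive degrees) with $\operatorname{Im}\varphi_n\subseteq QF_{n-1}$, and put $M=\operatorname{Im}\varphi_1$ and $M:_{F_0}Q=\{z\in F_0\mid Qz\subseteq M\}$. Put $N=\{1,\dots,n\}$, and let $K_\bullet$ be the Koszul complex of $x_1,\dots,x_n$: $K_p$ is free with basis $e_I$ ($I\subseteq N$, $\sharp I=p$) and $\partial_p(e_I)=\sum_{i\in I}(-1)^{s(i,I)}x_ie_{I\setminus\{i\}}$, where $s(i,I)=\sharp\{j\in I\mid j<i\}$. Write $\check e_i=e_{N\setminus\{i\}}$. Fix a free basis $\{v_\lambda\}_{\lambda\in\Lambda}$ of $F_n$, put $\widetilde\Lambda=\Lambda\times N$, and fix elements $v_{(\lambda,i)}\in F_{n-1}$, $(\lambda,i)\in\widetilde\Lambda$,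 with $\varphi_n(v_\lambda)=\sum_{i\in N}x_iv_{(\lambda,i)}$ for all $\lambda\in\Lambda$. (A) There is a chain map $\sigma_\bullet:F_n\otimes_RK_\bullet\to F_\bullet$ with $$\sigma_{n-1}(v_\lambda\otimes\check e_i)=(-1)^{n+i-1}v_{(\lambda,i)},\qquad \sigma_n(v_\lambda\otimes e_N)=(-1)^nv_\lambda \qquad(\lambda\in\Lambda,\ i\in N).\tag{i}$$ (B) There are a subset $\Lambda'\subseteq\widetilde\Lambda$, with complement ${}^*\Lambda=\widetilde\Lambda\setminus\Lambda'$, a finite subset $U\subseteq F_{n-1}$, and coefficients $a^{(\mu,j)}_{(\lambda,i)},b^{(\mu,j)}_u\in R$ such that $$\{v_{(\lambda,i)}\}_{(\lambda,i)\in\Lambda'}\cup U\ \text{ is a free basis of } F_{n-1},\tag{ii}$$ $$v_{(\mu,j)}=\sum_{(\lambda,i)\in\widetilde\Lambda}a^{(\mu,j)}_{(\lambda,i)}v_{(\lambda,i)}+\sum_{u\in U}b^{(\mu,j)}_uu\qquad\text{for all }(\mu,j)\in{}^*\Lambda,\tag{iii}$$ where $b^{(\mu,j)}_u\in\mathfrak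 m$ for all $u\in U$, and $a^{(\mu,j)}_{(\lambda,i)}\in\mathfrak m$ whenever $(\lambda,i)\in{}^*\Lambda$. (C) Let $\sigma_\bullet$ be any chain map as in (A), and $\Lambda',U,a,b$ any choices as in (B). The mapping cone of $\sigma_\bullet$ has $F_0$ in degree $0$ and $(F_n\otimes K_{p-1})\oplus F_p$ in degree $p\ge1$, with boundary maps $\psi_1(\xi,\eta)=\sigma_0(\xi)+\varphi_1(\eta)$ and $$\psi_p(\xi,\eta)=\bigl((F_n\otimes\partial_{p-1})(\xi),\ (-1)^{p-1}\sigma_{p-1}(\xi)+\varphi_p(\eta)\bigr)\qquad(p\ge2).$$ Define submodules ${}^*F_p$ of its terms as follows. * ${}^*F_0=F_0$, and ${}^*F_p=(F_n\otimes K_{p-1})\oplus F_p$ for $1\le p\le n-2$. * ${}^*F_{n-1}\subseteq(F_n\otimes K_{n-2})\oplus F_{n-1}$ is generated by the elements $[\lambda,I]=(v_\lambda\otimes e_I,0)$, for $\lambda\in\Lambda$, $I\subseteq N$, $\sharp I=n-2$, and $\langle u\rangle=(0,u)$, for $u\in U$. * ${}^*F_n\subseteq F_n\otimes K_{n-1}=(F_n\otimes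 K_{n-1})\oplus0$ is generated by the elements $${}^*v_{(\mu,j)}=(-1)^jv_\mu\otimes\check e_j+\sum_{(\lambda,i)\in\widetilde\Lambda}(-1)^{i-1}a^{(\mu,j)}_{(\lambda,i)}\,v_\lambda\otimes\check e_i,\qquad(\mu,j)\in{}^*\Lambda.$$ * ${}^*F_p=0$ for $p>n$. Then $\psi_p({}^*F_p)\subseteq{}^*F_{p-1}$ for all $p\ge 1$ and, with ${}^*\varphi_p:{}^*F_p\to{}^*F_{p-1}$ the restriction of $\psi_p$, $$0\to{}^*F_n\xrightarrow{{}^*\varphi_n}{}^*F_{n-1}\to\cdots\to{}^*F_1\xrightarrow{{}^*\varphi_1}{}^*F_0=F_0$$ is an acyclic complex of finitely generated free $R$-modules with the following properties. 1. $\operatorname{Im}{}^*\varphi_1=M:_{F_0}Q$ and $\operatorname{Im}{}^*\varphi_n\subseteq\mathfrak m\cdot{}^*F_{n-1}$. 2. $\{{}^*v_{(\mu,j)}\}_{(\mu,j)\in{}^*\Lambda}$ is a free basis of ${}^*F_n$. 3. $\{[\lambda,I]\}_{\lambda\in\Lambda,\,I\subseteq N,\,\sharp I=n-2}\cup\{\langle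 u\rangle\}_{u\in U}$ is a free basis of ${}^*F_{n-1}$. -/

import Mathlib

open scoped TensorProduct

universe u

/-- A Noetherian local ring `R` is Cohen-Macaulay if its depth equals its Krull dimension, i.e. if
its maximal ideal contains an `R`-regular sequence of length `dim R`. -/
structure IsCohenMacaulayLocal (R : Type*) [CommRing R] [IsLocalRing R] : Prop where
  noetherian : IsNoetherianRing R
  exists_regular : ∃ rs : List R, (∀ r ∈ rs, r ∈ IsLocalRing.maximalIdeal R) ∧
    RingTheory.Sequence.IsRegular R rs ∧ ringKrullDim R = rs.length

/-- `x₁, …, xₙ` is a system of parameters of the local ring `R`: `n = dim R` and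
`(x₁, …, xₙ)R` is primary to the maximal ideal. -/
structure IsSystemOfParameters {R : Type*} [CommRing R] [IsLocalRing R] {n : ℕ}
    (x : Fin n → R) : Prop where
  dim_eq : ringKrullDim R = n
  radical_eq : (Ideal.span (Set.range x)).radical = IsLocalRing.maximalIdeal R

/-- The submodule `M :_F Q = {z ∈ F | Q z ⊆ M}` of `F`. -/
def moduleColon {R F : Type*} [CommRing R] [AddCommGroup F] [Module R F]
    (M : Submodule R F) (Q : Ideal R) : Submodule R F where
  carrier := {z | ∀ q ∈ Q, q • z ∈ M}
  add_mem' := fun ha hb q hq => by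
    rw [smul_add]; exact M.add_mem (ha q hq) (hb q hq)
  zero_mem' := fun q _ => by rw [smul_zero]; exact M.zero_mem
  smul_mem' := fun c z hz q hq => by
    rw [smul_comm]; exact M.smul_mem c (hz q hq)

/-- `0 → F n → ⋯ → F 1 → F 0` is an acyclic complex of finitely generated free `R`-modules of
length (at most) `n`: the sequence is exact in every positive degree (at `F n` this says that
`F n → F (n-1)` is injective, since `F (n+1) = 0`).  The map `φ p` goes from degree `p + 1` to
degree `p`. -/
structure IsAcyclicFreeComplex {R : Type*} [CommRing R] (n : ℕ) (F : ℕ → Type*)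
    [∀ p, AddCommGroup (F p)] [∀ p, Module R (F p)] (φ : ∀ p, F (p + 1) →ₗ[R] F p) : Prop where
  finite : ∀ p, Module.Finite R (F p)
  free : ∀ p, Module.Free R (F p)
  length : ∀ p, n < p → Subsingleton (F p)
  exact : ∀ p, Function.Exact (φ (p + 1)) (φ p)

namespace StarTransform

/-! ### The Koszul complex -/

/-- The `p`-th module `K_p` of the Koszul complex of `n` elements: the free `R`-module with basis
`e_I`, where `I` runs through the `p`-element subsets of `{0, …, n-1}`. -/
abbrev Koszul (R : Type u) [CommRing R] (n p : ℕ) : Type u := Set.powersetCard (Fin n) p →₀ R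

/-- The basis element `e_I` of `K_p`. -/
noncomputable def koszulE (R : Type u) [CommRing R] {n p : ℕ} (I : Set.powersetCard (Fin n) p) :
    Koszul R n p := Finsupp.single I 1

/-- `I ∖ {i}`, for an element `i` of a set `I` with `p + 1` elements. -/
def eraseCard {n p : ℕ} (I : Set.powersetCard (Fin n) (p + 1)) (i : {i // i ∈ (I : Finset (Fin n))}) :
    Set.powersetCard (Fin n) p :=
  ⟨(I : Finset (Fin n)).erase i, by
    have h1 : (I : Finset (Fin n)).card = p + 1 := I.2
    change ((I : Finset (Fin n)).erase i).card = p
    rw [Finset.card_erase_of_mem i.2, h1, Nat.add_sub_cancel]⟩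

/-- The boundary map `K_{p+1} → K_p`, `e_I ↦ ∑_{i ∈ I} (-1)^{s(i, I)} x_i e_{I ∖ {i}}`, where
`s(i, I)` is the number of elements of `I` below `i`. -/
noncomputable def koszulD {R : Type u} [CommRing R] {n : ℕ} (x : Fin n → R) (p : ℕ) :
    Koszul R n (p + 1) →ₗ[R] Koszul R n p :=
  Finsupp.linearCombination R fun I : Set.powersetCard (Fin n) (p + 1) =>
    ∑ i : {i // i ∈ (I : Finset (Fin n))},
      ((-1 : R) ^ ((I : Finset (Fin n)).filter (· < (i : Fin n))).card * x i) •
        koszulE R (eraseCard I i)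

/-- The whole index set `N`, as an `n`-element set. -/
def fullSet (n : ℕ) : Set.powersetCard (Fin n) n :=
  ⟨Finset.univ, by change (Finset.univ : Finset (Fin n)).card = n; simp⟩

/-- The index set `N ∖ {i}`, so that `ě_i = e_{N ∖ {i}}`. -/
def coSingleton {n : ℕ} (i : Fin (n + 1)) : Set.powersetCard (Fin (n + 1)) n :=
  eraseCard (fullSet (n + 1)) ⟨i, Finset.mem_univ i⟩

/-! ### The mapping cone -/

/-- The modules of the mapping cone of a map of complexes `G → F`: `F 0` in degree `0` and
`G p ⊕ F (p + 1)` in degree `p + 1`. -/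
@[reducible] def Cone (G F : ℕ → Type u) : ℕ → Type u
  | 0 => F 0
  | p + 1 => G p × F (p + 1)

noncomputable instance instAddCommGroupCone (G F : ℕ → Type u) [∀ p, AddCommGroup (G p)]
    [∀ p, AddCommGroup (F p)] : ∀ p, AddCommGroup (Cone G F p)
  | 0 => inferInstanceAs (AddCommGroup (F 0))
  | p + 1 => inferInstanceAs (AddCommGroup (G p × F (p + 1)))

noncomputable instance instModuleCone (R : Type u) [CommRing R] (G F : ℕ → Type u)
    [∀ p, AddCommGroup (G p)] [∀ p, AddCommGroup (F p)] [∀ p, Module R (G p)]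
    [∀ p, Module R (F p)] : ∀ p, Module R (Cone G F p)
  | 0 => inferInstanceAs (Module R (F 0))
  | p + 1 => inferInstanceAs (Module R (G p × F (p + 1)))

/-- The boundary maps `ψ` of the mapping cone of `σ : G → F`; `coneD d φ σ p` is the map from degree
`p + 1` to degree `p`.  From degree `1` to `0` it is `(g, f) ↦ σ g + φ f`, and from degree `p` to
degree `p - 1`, for `p ≥ 2`, it is `(g, f) ↦ (d g, (-1)^{p-1} σ g + φ f)`. -/
noncomputable def coneD {R : Type u} [CommRing R] {G F : ℕ → Type u}
    [∀ p, AddCommGroup (G p)] [∀ p, AddCommGroup (F p)] [∀ p, Module R (G p)]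
    [∀ p, Module R (F p)] (d : ∀ p, G (p + 1) →ₗ[R] G p) (φ : ∀ p, F (p + 1) →ₗ[R] F p)
    (σ : ∀ p, G p →ₗ[R] F p) : ∀ p, Cone G F (p + 1) →ₗ[R] Cone G F p
  | 0 => ((σ 0).coprod (φ 0) : G 0 × F 1 →ₗ[R] F 0)
  | p + 1 => (((d p) ∘ₗ LinearMap.fst R (G (p + 1)) (F (p + 2))).prod
      (((-1 : R) ^ (p + 1) • σ (p + 1)).coprod (φ (p + 1))) :
        G (p + 1) × F (p + 2) →ₗ[R] G p × F (p + 1))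

/-! ### The `*`-transform

Throughout, `n = k + 2` and `F` is a complex with boundary maps `φ`, of length `n`; the basis
`v` of `F n` is indexed by `Λ`. -/

/-- The complex `F_n ⊗ K` with its boundary map `F_n ⊗ ∂`: the modules. -/
abbrev TensorK (R : Type u) [CommRing R] (k : ℕ) (F : ℕ → Type u) [∀ p, AddCommGroup (F p)]
    [∀ p, Module R (F p)] (p : ℕ) : Type u := F (k + 2) ⊗[R] Koszul R (k + 2) p

/-- The boundary map of `F_n ⊗ K`. -/
noncomputable def tensorD {R : Type u} [CommRing R] {k : ℕ} (F : ℕ → Type u)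
    [∀ p, AddCommGroup (F p)] [∀ p, Module R (F p)] (x : Fin (k + 2) → R) (p : ℕ) :
    TensorK R k F (p + 1) →ₗ[R] TensorK R k F p :=
  (koszulD x p).lTensor (F (k + 2))

/-- `σ : F_n ⊗ K → F` is a chain map with `σ_{n-1}(v_λ ⊗ ě_i) = (-1)^{n+i-1} v_{(λ,i)}` (where
`i ∈ {1, …, n}`; here `i` counts from `0`) and `σ_n(v_λ ⊗ e_N) = (-1)^n v_λ`. -/
structure IsComparison {R : Type u} [CommRing R] {k : ℕ} {F : ℕ → Type u}
    [∀ p, AddCommGroup (F p)] [∀ p, Module R (F p)] (x : Fin (k + 2) → R)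
    (φ : ∀ p, F (p + 1) →ₗ[R] F p) {Λ : Type*} (v : Module.Basis Λ R (F (k + 2)))
    (w : Λ × Fin (k + 2) → F (k + 1)) (σ : ∀ p, TensorK R k F p →ₗ[R] F p) : Prop where
  comm : ∀ p, φ p ∘ₗ σ (p + 1) = σ p ∘ₗ tensorD F x p
  sub_top : ∀ (l : Λ) (i : Fin (k + 2)), σ (k + 1) (v l ⊗ₜ[R] koszulE R (coSingleton i)) =
    (-1 : R) ^ (k + 2 + (i : ℕ)) • w (l, i)
  top : ∀ l : Λ, σ (k + 2) (v l ⊗ₜ[R] koszulE R (fullSet (k + 2))) = (-1 : R) ^ (k + 2) • v l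

/-- The choices made to remove the non-minimal components: `S` (the `Λ'` of the notation
`Λ' ⊆ Λ × N`) and `U ⊆ F_{n-1}` such that `{v_{(λ,i)}}_{(λ,i) ∈ S} ∪ U` is a free basis of
`F_{n-1}`, and for `(μ,j) ∉ S` coefficients `a, b` with
`v_{(μ,j)} = ∑ a^{(μ,j)}_{(λ,i)} v_{(λ,i)} + ∑_{u ∈ U} b^{(μ,j)}_u u`, where `b^{(μ,j)}_u ∈ 𝔪`, and
`a^{(μ,j)}_{(λ,i)} ∈ 𝔪` whenever `(λ,i) ∉ S`. -/
structure IsReduction {R : Type u} [CommRing R] [IsLocalRing R] {k : ℕ} {F : ℕ → Type u}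
    [∀ p, AddCommGroup (F p)] [∀ p, Module R (F p)] {Λ : Type*} [Fintype Λ]
    (w : Λ × Fin (k + 2) → F (k + 1)) (S : Set (Λ × Fin (k + 2))) (U : Finset (F (k + 1)))
    (a : Λ × Fin (k + 2) → Λ × Fin (k + 2) → R) (b : Λ × Fin (k + 2) → F (k + 1) → R) :
    Prop where
  linearIndependent : LinearIndependent R
    (Sum.elim (fun q : S => w q) (fun y : U => (y : F (k + 1))) : S ⊕ U → F (k + 1))
  span_eq_top : Submodule.span R (w '' S ∪ (U : Set (F (k + 1)))) = ⊤
  expand : ∀ q ∉ S, w q = ∑ r, a q r • w r + ∑ y ∈ U, b q y • y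
  a_mem : ∀ q ∉ S, ∀ r ∉ S, a q r ∈ IsLocalRing.maximalIdeal R
  b_mem : ∀ q ∉ S, ∀ y ∈ U, b q y ∈ IsLocalRing.maximalIdeal R

/-- The element `*v_{(μ,j)} = (-1)^j v_μ ⊗ ě_j + ∑ (-1)^{i-1} a^{(μ,j)}_{(λ,i)} v_λ ⊗ ě_i` of
`F_n ⊗ K_{n-1}` (where `i, j ∈ {1, …, n}`; the indices below count from `0`). -/
noncomputable def starV {R : Type u} [CommRing R] {k : ℕ} {F : ℕ → Type u}
    [∀ p, AddCommGroup (F p)] [∀ p, Module R (F p)] {Λ : Type*} [Fintype Λ]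
    (v : Module.Basis Λ R (F (k + 2))) (a : Λ × Fin (k + 2) → Λ × Fin (k + 2) → R)
    (q : Λ × Fin (k + 2)) : TensorK R k F (k + 1) :=
  (-1 : R) ^ ((q.2 : ℕ) + 1) • (v q.1 ⊗ₜ[R] koszulE R (coSingleton q.2)) +
    ∑ r : Λ × Fin (k + 2),
      ((-1 : R) ^ (r.2 : ℕ) * a q r) • (v r.1 ⊗ₜ[R] koszulE R (coSingleton r.2))

/-- The family `[λ, I] = (v_λ ⊗ e_I, 0)`, `⟨u⟩ = (0, u)` of elements of
`(F_n ⊗ K_{n-2}) ⊕ F_{n-1}`, for `λ ∈ Λ`, `I` a subset of `N` with `n - 2` elements, `u ∈ U`. -/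
noncomputable def subTopGen {R : Type u} [CommRing R] {k : ℕ} {F : ℕ → Type u}
    [∀ p, AddCommGroup (F p)] [∀ p, Module R (F p)] {Λ : Type*}
    (v : Module.Basis Λ R (F (k + 2))) (U : Finset (F (k + 1))) :
    (Λ × Set.powersetCard (Fin (k + 2)) k) ⊕ U → Cone (TensorK R k F) F (k + 1) :=
  Sum.elim (fun t => (v t.1 ⊗ₜ[R] koszulE R t.2, 0)) (fun y => (0, (y : F (k + 1))))

/-- The family of the `*v_q`, `q ∉ S`.  The module `F_n ⊗ K_{n-1}` is viewed as the first summand of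
`(F_n ⊗ K_{n-1}) ⊕ F_n`, the degree `n` module of the mapping cone. -/
noncomputable def topGen {R : Type u} [CommRing R] {k : ℕ} {F : ℕ → Type u}
    [∀ p, AddCommGroup (F p)] [∀ p, Module R (F p)] {Λ : Type*} [Fintype Λ]
    (v : Module.Basis Λ R (F (k + 2))) (S : Set (Λ × Fin (k + 2)))
    (a : Λ × Fin (k + 2) → Λ × Fin (k + 2) → R) :
    (Sᶜ : Set (Λ × Fin (k + 2))) → Cone (TensorK R k F) F (k + 2) :=
  fun q => (starV v a q, 0)

/-- The modules `*F_p` of the `*`-transform, as submodules of the modules of the mapping cone of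
`σ : F_n ⊗ K → F`: the whole module in degrees `p ≤ n - 2` (so `F_0` for `p = 0` and
`(F_n ⊗ K_{p-1}) ⊕ F_p` for `1 ≤ p ≤ n - 2`); the submodule of `(F_n ⊗ K_{n-2}) ⊕ F_{n-1}`
generated by the `[λ, I]` and the `⟨u⟩` in degree `n - 1`; the submodule of `F_n ⊗ K_{n-1}`
generated by the `*v_q` in degree `n`; and `0` in degrees `p > n`. -/
noncomputable def starF {R : Type u} [CommRing R] {k : ℕ} {F : ℕ → Type u}
    [∀ p, AddCommGroup (F p)] [∀ p, Module R (F p)] {Λ : Type*} [Fintype Λ]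
    (v : Module.Basis Λ R (F (k + 2))) (S : Set (Λ × Fin (k + 2))) (U : Finset (F (k + 1)))
    (a : Λ × Fin (k + 2) → Λ × Fin (k + 2) → R) :
    ∀ p, Submodule R (Cone (TensorK R k F) F p) :=
  Function.update
    (Function.update (fun p => if p ≤ k then ⊤ else ⊥)
      (k + 1) (Submodule.span R (Set.range (subTopGen v U))))
    (k + 2) (Submodule.span R (Set.range (topGen v S a)))

/-- The boundary maps `*φ`: the restrictions to the `*F_p` of the boundary maps of the mapping cone of
`σ`.  Here `h` says that these map `*F_{p+1}` into `*F_p`. -/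
noncomputable def starD {R : Type u} [CommRing R] {k : ℕ} {F : ℕ → Type u}
    [∀ p, AddCommGroup (F p)] [∀ p, Module R (F p)] (x : Fin (k + 2) → R)
    (φ : ∀ p, F (p + 1) →ₗ[R] F p) {Λ : Type*} [Fintype Λ]
    (v : Module.Basis Λ R (F (k + 2))) (σ : ∀ p, TensorK R k F p →ₗ[R] F p)
    (S : Set (Λ × Fin (k + 2))) (U : Finset (F (k + 1)))
    (a : Λ × Fin (k + 2) → Λ × Fin (k + 2) → R)
    (h : ∀ p, ∀ c ∈ starF v S U a (p + 1), coneD (tensorD F x) φ σ p c ∈ starF v S U a p) (p : ℕ) :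
    starF v S U a (p + 1) →ₗ[R] starF v S U a p :=
  (coneD (tensorD F x) φ σ p).restrict (h p)

end StarTransform

/-! Since `R` is Cohen–Macaulay, F_n ⊗ K resolves F_n/QF_n, while F resolves F_0/M. The chain map σ
induces a map F_n/QF_n → F_0/M which is injective with image (M : Q)/M, so its mapping cone is
acyclic and resolves F_0/(M : Q).

Everything rests on the vanishing of H^p(Hom(K, N)) for p < n and `N` free
(`koszul_cohomology_vanishing`). It lets chain maps K → F be built downwards from their two top
components (`exists_koszul_chain_map`), which gives σ. It also shows that a map K_0 → F_0 carrying
QK_0 into M agrees with some σ_0(f ⊗ -) modulo M (`IsComparison.exists_homotopy`), which gives the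
image. Conversely, if σ_0(f ⊗ -) lands in M, then σ(f ⊗ -) is null-homotopic because F is acyclic.
As F_{n+1} = 0, evaluating the homotopy at e_N gives f ∈ QF_n (`IsComparison.mem_range_of_map_mem`),
which is the injectivity.

The cone has length n + 1 and must be cut down. Its top term F_n ⊗ K_n maps isomorphically onto the
summand F_n in degree n, and the pair cancels. The remaining F_n ⊗ K_{n-1} has a basis sent by ±
σ_{n-1} to the v_(λ,i); the basis elements indexed by Λ' cancel against part of a basis of F_{n-1}.
What is left is the span of `U` in degree n - 1 and the preimage of that span in degree n
(`mem_starSpan_iff`). By Nakayama the *v form a basis of this preimage (`IsReduction.exists_basis`),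
and minimality at the top follows from Q ⊆ 𝔪 and b ∈ 𝔪. -/

namespace StarTransform

/-! ### The Koszul complex and the homotopies given by multiplication with e_i. -/

section Koszul

variable {R : Type u} [CommRing R] {n : ℕ}

/-- The sign `(-1)^{s(i, I)}`. -/
def koszulSign (R : Type u) [CommRing R] (i : Fin n) (I : Finset (Fin n)) : R :=
  (-1) ^ (I.filter (· < i)).card

lemma koszulSign_mul_self (i : Fin n) (I : Finset (Fin n)) :
    koszulSign R i I * koszulSign R i I = 1 := by
  rw [koszulSign, ← mul_pow]; simp

lemma koszulSign_insert {i : Fin n} {I : Finset (Fin n)} (hi : i ∉ I) (j : Fin n) :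
    koszulSign R j (insert i I) = (if i < j then -1 else 1) * koszulSign R j I := by
  unfold koszulSign
  rw [Finset.filter_insert]
  split_ifs with h
  · rw [Finset.card_insert_of_notMem (by simp [hi]), pow_succ]; ring
  · rw [one_mul]

lemma koszulSign_insert_self (i : Fin n) (I : Finset (Fin n)) :
    koszulSign R i (insert i I) = koszulSign R i I := by
  unfold koszulSign
  rw [Finset.filter_insert, if_neg (lt_irrefl i)]

/-- This is e_i ∧ e_j = -e_j ∧ e_i at the level of signs: exactly one of i < j and j < i holds, so
exactly one side picks up an extra -1. -/
lemma koszulSign_swap {i j : Fin n} (hij : i ≠ j) {I : Finset (Fin n)} (hi : i ∉ I) (hj : j ∉ I) :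
    koszulSign R i (insert j I) * koszulSign R j I =
      -(koszulSign R j (insert i I) * koszulSign R i I) := by
  rw [koszulSign_insert hi, koszulSign_insert hj]
  rcases lt_or_gt_of_ne hij with h | h
  · rw [if_neg h.not_gt, if_pos h]; ring
  · rw [if_pos h, if_neg h.not_gt]; ring

/-- The Koszul differential on the free module with basis the set of all subsets of `Fin n`. -/
noncomputable def totalD (x : Fin n → R) : (Finset (Fin n) →₀ R) →ₗ[R] (Finset (Fin n) →₀ R) :=
  Finsupp.linearCombination R fun I => ∑ i ∈ I, (koszulSign R i I * x i) • Finsupp.single (I.erase i) 1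

lemma totalD_single (x : Fin n → R) (I : Finset (Fin n)) :
    totalD x (Finsupp.single I 1) =
      ∑ i ∈ I, (koszulSign R i I * x i) • Finsupp.single (I.erase i) 1 := by
  simp [totalD]

/-- Multiplication by `e_i`. -/
noncomputable def totalS (R : Type u) [CommRing R] (i : Fin n) :
    (Finset (Fin n) →₀ R) →ₗ[R] (Finset (Fin n) →₀ R) :=
  Finsupp.linearCombination R fun I =>
    if i ∈ I then 0 else koszulSign R i I • Finsupp.single (insert i I) 1

lemma totalS_single_of_mem {i : Fin n} {I : Finset (Fin n)} (h : i ∈ I) :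
    totalS R i (Finsupp.single I 1) = 0 := by
  simp [totalS, h]

lemma totalS_single_of_notMem {i : Fin n} {I : Finset (Fin n)} (h : i ∉ I) :
    totalS R i (Finsupp.single I 1) = koszulSign R i I • Finsupp.single (insert i I) 1 := by
  simp [totalS, h]

/-- The term removing `i` and then `j` cancels the one removing `j` and then `i`. -/
lemma totalD_comp_self (x : Fin n → R) : totalD x ∘ₗ totalD x = 0 := by
  refine Finsupp.lhom_ext' fun I => LinearMap.ext_ring ?_
  simp only [LinearMap.comp_apply, Finsupp.lsingle_apply, LinearMap.zero_apply, totalD_single,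
    map_sum, map_smul, Finset.smul_sum]
  rw [Finset.sum_sigma' I (fun i => I.erase i)]
  refine Finset.sum_involution (fun p _ => ⟨p.2, p.1⟩) ?_ ?_ ?_ ?_
  · rintro ⟨i, j⟩ h
    simp only [Finset.mem_sigma, Finset.mem_erase] at h
    obtain ⟨hi, hji, hj⟩ := h
    obtain ⟨J, hiJ, hjJ, rfl⟩ : ∃ J, i ∉ J ∧ j ∉ J ∧ I = insert i (insert j J) :=
      ⟨(I.erase i).erase j, by simp, by simp, by
        rw [Finset.insert_erase (by simp [hji, hj]), Finset.insert_erase hi]⟩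
    have e1 : (insert i (insert j J)).erase i = insert j J :=
      Finset.erase_insert (by simp [hiJ, hji.symm])
    have e2 : (insert i (insert j J)).erase j = insert i J := by
      rw [Finset.insert_comm]; exact Finset.erase_insert (by simp [hjJ, hji])
    simp only [e1, e2, Finset.erase_insert hiJ, Finset.erase_insert hjJ, smul_smul, ← add_smul]
    rw [koszulSign_insert_self, koszulSign_insert_self, Finset.insert_comm,
      koszulSign_insert_self, koszulSign_insert_self]
    have := koszulSign_swap (R := R) hji.symm hiJ hjJ
    convert zero_smul R _
    linear_combination x i * x j * this
  · rintro ⟨i, j⟩ h _ h'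
    simp only [Finset.mem_sigma, Finset.mem_erase] at h
    exact h.2.1 (by simpa using congrArg Sigma.fst h')
  · rintro ⟨i, j⟩ h
    simp only [Finset.mem_sigma, Finset.mem_erase] at h ⊢
    exact ⟨h.2.2, h.2.1.symm, h.1⟩
  · rintro ⟨i, j⟩ h
    rfl

/-- Multiplication by e_i is a homotopy from x_i to 0; this is why Q annihilates Koszul homology and
cohomology. -/
lemma totalD_totalS (x : Fin n → R) (i : Fin n) :
    totalD x ∘ₗ totalS R i + totalS R i ∘ₗ totalD x = x i • LinearMap.id := by
  refine Finsupp.lhom_ext' fun I => LinearMap.ext_ring ?_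
  simp only [LinearMap.comp_apply, Finsupp.lsingle_apply, LinearMap.add_apply, totalD_single,
    map_sum, map_smul, LinearMap.smul_apply, LinearMap.id_apply]
  by_cases hi : i ∈ I
  · obtain ⟨J, hJ, rfl⟩ : ∃ J, i ∉ J ∧ I = insert i J :=
      ⟨I.erase i, by simp, (Finset.insert_erase hi).symm⟩
    rw [totalS_single_of_mem hi, map_zero, zero_add, Finset.sum_eq_single i]
    · rw [Finset.erase_insert hJ, totalS_single_of_notMem hJ, smul_smul, koszulSign_insert_self]
      congr 1
      linear_combination x i * koszulSign_mul_self (R := R) i J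
    · intro j _ hj
      rw [totalS_single_of_mem (by simp [hj.symm]), smul_zero]
    · exact fun h => absurd hi h
  · rw [totalS_single_of_notMem hi, map_smul, totalD_single, Finset.sum_insert hi,
      Finset.erase_insert hi, koszulSign_insert_self, smul_add, add_assoc, smul_smul, ← mul_assoc,
      koszulSign_mul_self, one_mul, Finset.smul_sum, ← Finset.sum_add_distrib]
    convert add_zero _
    refine Finset.sum_eq_zero fun j hj => ?_
    obtain ⟨J, hJ, rfl⟩ : ∃ J, j ∉ J ∧ I = insert j J :=
      ⟨I.erase j, by simp, (Finset.insert_erase hj).symm⟩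
    have hij : i ≠ j := by rintro rfl; exact hi hj
    have hiJ : i ∉ J := fun h => hi (Finset.mem_insert_of_mem h)
    rw [Finset.erase_insert hJ, totalS_single_of_notMem hiJ, Finset.insert_comm,
      Finset.erase_insert (by simp [hJ, hij.symm]), smul_smul, smul_smul, ← add_smul]
    convert zero_smul R _
    rw [koszulSign_insert_self, koszulSign_insert_self]
    have := koszulSign_swap (R := R) hij hiJ hJ
    -- The swap identity is multiplied by two signs so that their squares, both equal to 1, can be
    -- cancelled.
    linear_combination x j * koszulSign R j J * koszulSign R j (insert i J) * this -
      x j * koszulSign R i (insert j J) * koszulSign R j (insert i J) *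
        koszulSign_mul_self (R := R) j J -
      x j * koszulSign R i J * koszulSign R j J * koszulSign_mul_self (R := R) j (insert i J)

/-- The inclusion of `K_p` into the free module on all subsets. -/
noncomputable def koszulIncl (R : Type u) [CommRing R] (n p : ℕ) :
    Koszul R n p →ₗ[R] (Finset (Fin n) →₀ R) :=
  Finsupp.lmapDomain R R fun I => (I : Finset (Fin n))

lemma koszulIncl_injective (p : ℕ) : Function.Injective (koszulIncl R n p) :=
  Finsupp.mapDomain_injective Subtype.val_injective

lemma koszulIncl_single {p : ℕ} (I : Set.powersetCard (Fin n) p) :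
    koszulIncl R n p (koszulE R I) = Finsupp.single (I : Finset (Fin n)) 1 := by
  simp [koszulIncl, koszulE]

lemma koszulD_koszulE (x : Fin n → R) {p : ℕ} (I : Set.powersetCard (Fin n) (p + 1)) :
    koszulD x p (koszulE R I) = ∑ i : {i // i ∈ (I : Finset (Fin n))},
      (koszulSign R (i : Fin n) (I : Finset (Fin n)) * x i) • koszulE R (eraseCard I i) := by
  simp [koszulD, koszulE, koszulSign]

lemma koszul_hom_ext {p : ℕ} {N : Type*} [AddCommGroup N] [Module R N]
    {f g : Koszul R n p →ₗ[R] N} (h : ∀ I, f (koszulE R I) = g (koszulE R I)) : f = g :=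
  Finsupp.lhom_ext' fun I => LinearMap.ext_ring (h I)

/-- Identities are proved on the free module on all subsets, where no cardinalities have to be
tracked, and pulled back along the injective `koszulIncl`. -/
lemma koszulIncl_comp_koszulD (x : Fin n → R) (p : ℕ) :
    koszulIncl R n p ∘ₗ koszulD x p = totalD x ∘ₗ koszulIncl R n (p + 1) := by
  refine koszul_hom_ext fun I => ?_
  simp only [LinearMap.comp_apply, koszulD_koszulE, map_sum, map_smul, koszulIncl_single,
    totalD_single]
  exact Finset.sum_coe_sort (I : Finset (Fin n)) fun i =>
    (koszulSign R i (I : Finset (Fin n)) * x i) • Finsupp.single ((I : Finset (Fin n)).erase i) 1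

lemma koszulD_comp_koszulD (x : Fin n → R) (p : ℕ) : koszulD x p ∘ₗ koszulD x (p + 1) = 0 := by
  rw [← LinearMap.cancel_left (koszulIncl_injective p), ← LinearMap.comp_assoc,
    koszulIncl_comp_koszulD, LinearMap.comp_assoc, koszulIncl_comp_koszulD, ← LinearMap.comp_assoc,
    totalD_comp_self, LinearMap.zero_comp, LinearMap.comp_zero]

/-- Multiplication by `e_i`, as a map `K_p → K_{p+1}`. -/
noncomputable def koszulS (R : Type u) [CommRing R] (i : Fin n) (p : ℕ) :
    Koszul R n p →ₗ[R] Koszul R n (p + 1) :=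
  Finsupp.linearCombination R fun I =>
    if h : i ∈ (I : Finset (Fin n)) then 0 else koszulSign R i (I : Finset (Fin n)) •
      koszulE R ⟨insert i (I : Finset (Fin n)), by
        have h1 : (I : Finset (Fin n)).card = p := I.2
        change (insert i (I : Finset (Fin n))).card = p + 1
        rw [Finset.card_insert_of_notMem h, h1]⟩

lemma koszulIncl_comp_koszulS (i : Fin n) (p : ℕ) :
    koszulIncl R n (p + 1) ∘ₗ koszulS R i p = totalS R i ∘ₗ koszulIncl R n p := by
  refine koszul_hom_ext fun I => ?_
  rw [LinearMap.comp_apply, LinearMap.comp_apply, koszulIncl_single]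
  by_cases h : i ∈ (I : Finset (Fin n))
  · rw [totalS_single_of_mem h, koszulS, koszulE, Finsupp.linearCombination_single, dif_pos h,
      smul_zero, map_zero]
  · rw [totalS_single_of_notMem h, koszulS, koszulE, Finsupp.linearCombination_single, dif_neg h,
      one_smul, map_smul, koszulIncl_single]

lemma koszulD_koszulS (x : Fin n → R) (i : Fin n) (p : ℕ) :
    koszulD x (p + 1) ∘ₗ koszulS R i (p + 1) + koszulS R i p ∘ₗ koszulD x p =
      x i • LinearMap.id := by
  rw [← LinearMap.cancel_left (koszulIncl_injective (p + 1)), LinearMap.comp_add,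
    ← LinearMap.comp_assoc, koszulIncl_comp_koszulD, LinearMap.comp_assoc, koszulIncl_comp_koszulS,
    ← LinearMap.comp_assoc _ _ (koszulIncl R n (p + 1)), koszulIncl_comp_koszulS,
    LinearMap.comp_assoc, koszulIncl_comp_koszulD, ← LinearMap.comp_assoc,
    ← LinearMap.comp_assoc, ← LinearMap.add_comp, totalD_totalS, LinearMap.smul_comp,
    LinearMap.comp_smul, LinearMap.id_comp, LinearMap.comp_id]

/-- In degree 0 the second term of the homotopy formula drops out, because the differential kills
e_∅. -/
lemma koszulD_koszulS_zero (x : Fin n → R) (i : Fin n) :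
    koszulD x 0 ∘ₗ koszulS R i 0 = x i • LinearMap.id := by
  rw [← LinearMap.cancel_left (koszulIncl_injective 0),
    ← LinearMap.comp_assoc, koszulIncl_comp_koszulD, LinearMap.comp_assoc, koszulIncl_comp_koszulS,
    ← LinearMap.comp_assoc]
  have h := totalD_totalS x i
  have h0 : totalD x ∘ₗ koszulIncl R n 0 = 0 := by
    refine koszul_hom_ext fun I => ?_
    have hI : (I : Finset (Fin n)) = ∅ := Finset.card_eq_zero.1 I.2
    rw [LinearMap.comp_apply, koszulIncl_single, totalD_single, hI, Finset.sum_empty,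
      LinearMap.zero_apply]
  have h1 := congrArg (· ∘ₗ koszulIncl R n 0) h
  simp only [LinearMap.add_comp] at h1
  rw [LinearMap.comp_assoc (koszulIncl R n 0) (totalD x) (totalS R i), h0, LinearMap.comp_zero,
    add_zero] at h1
  rw [h1, LinearMap.smul_comp, LinearMap.comp_smul, LinearMap.id_comp, LinearMap.comp_id]

lemma koszulD_mem (x : Fin n → R) {p : ℕ} (c : Koszul R n (p + 1)) :
    koszulD x p c ∈ Ideal.span (Set.range x) • (⊤ : Submodule R (Koszul R n p)) := by
  suffices h : LinearMap.range (koszulD x p) ≤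
      Ideal.span (Set.range x) • (⊤ : Submodule R (Koszul R n p)) from h ⟨c, rfl⟩
  rw [koszulD, Finsupp.range_linearCombination, Submodule.span_le]
  rintro _ ⟨I, rfl⟩
  refine Submodule.sum_mem _ fun i _ => Submodule.smul_mem_smul ?_ trivial
  exact Ideal.mul_mem_left _ _ (Ideal.subset_span ⟨_, rfl⟩)

lemma subsingleton_koszul {p : ℕ} (hp : n < p) : Subsingleton (Koszul R n p) := by
  have : IsEmpty (Set.powersetCard (Fin n) p) := ⟨fun I => by
    have h1 : (I : Finset (Fin n)).card = p := I.2
    have h2 := Finset.card_le_univ (I : Finset (Fin n))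
    rw [h1, Fintype.card_fin] at h2
    omega⟩
  infer_instance

end Koszul

/-! ### Vanishing of Koszul homology and cohomology over a Cohen–Macaulay ring. -/

section DepthSensitivity

open RingTheory.Sequence
open scoped Pointwise

variable {R : Type u} [CommRing R]

lemma exists_comp_eq_of_range_le {P A B : Type*} [AddCommGroup P] [Module R P]
    [Module.Projective R P] [AddCommGroup A] [Module R A] [AddCommGroup B] [Module R B]
    (f : A →ₗ[R] B) (g : P →ₗ[R] B) (h : LinearMap.range g ≤ LinearMap.range f) :
    ∃ s : P →ₗ[R] A, f ∘ₗ s = g := by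
  obtain ⟨s, hs⟩ := Module.projective_lifting_property f.rangeRestrict
    (g.codRestrict (LinearMap.range f) fun c => h ⟨c, rfl⟩) f.surjective_rangeRestrict
  exact ⟨s, LinearMap.ext fun c => congrArg Subtype.val (LinearMap.congr_fun hs c)⟩

/-- Used with `Z` the cycles and `B` the boundaries: homology is killed by Q, hence by a power of
any y in the radical of Q, so it vanishes as soon as y acts injectively on it. -/
lemma mem_of_pow_smul_mem {A : Type*} [AddCommGroup A] [Module R A] (Z B : Submodule R A) (y : R)
    (h : ∀ g ∈ Z, y • g ∈ B → g ∈ B) (t : ℕ) : ∀ g ∈ Z, y ^ t • g ∈ B → g ∈ B := by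
  induction t with
  | zero => intro g _ hg; simpa using hg
  | succ t ih =>
    intro g hg hgB
    rw [pow_succ', mul_smul] at hgB
    exact ih g hg (h _ (Z.smul_mem _ hg) hgB)

lemma smul_mem_of_mem_span {A : Type*} [AddCommGroup A] [Module R A] (B : Submodule R A)
    {ι : Type*} (x : ι → R) (g : A) (h : ∀ i, x i • g ∈ B) {r : R}
    (hr : r ∈ Ideal.span (Set.range x)) : r • g ∈ B := by
  suffices h' : Ideal.span (Set.range x) ≤ B.comap (LinearMap.toSpanSingleton R A g) from h' hr
  rw [Ideal.span_le]
  rintro _ ⟨i, rfl⟩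
  exact h i

lemma exists_smul_comp_of_mkQ_comp_eq_zero {P N : Type*} [AddCommGroup P] [Module R P]
    [Module.Projective R P] [AddCommGroup N] [Module R N] (y : R) (f : P →ₗ[R] N)
    (hf : (y • (⊤ : Submodule R N)).mkQ ∘ₗ f = 0) : ∃ g : P →ₗ[R] N, f = y • g := by
  obtain ⟨g, hg⟩ := exists_comp_eq_of_range_le (LinearMap.lsmul R N y) f (by
    rintro _ ⟨c, rfl⟩
    have h := LinearMap.congr_fun hf c
    rw [LinearMap.comp_apply, LinearMap.zero_apply, Submodule.mkQ_apply,
      Submodule.Quotient.mk_eq_zero, Submodule.mem_smul_pointwise_iff_exists] at h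
    obtain ⟨b, -, hb⟩ := h
    exact ⟨b, hb⟩)
  exact ⟨g, hg.symm⟩

variable {n : ℕ} (x : Fin n → R)

lemma smul_koszul_cochain_zero {N : Type*} [AddCommGroup N] [Module R N]
    (g : Koszul R n 0 →ₗ[R] N) (hg : g ∘ₗ koszulD x 0 = 0) {r : R}
    (hr : r ∈ Ideal.span (Set.range x)) : r • g = 0 := by
  rw [← Submodule.mem_bot R]
  refine smul_mem_of_mem_span ⊥ x g (fun i => ?_) hr
  rw [Submodule.mem_bot, ← LinearMap.comp_id g, ← LinearMap.comp_smul, ← koszulD_koszulS_zero,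
    ← LinearMap.comp_assoc, hg, LinearMap.zero_comp]

lemma smul_koszul_cochain {N : Type*} [AddCommGroup N] [Module R N] {p : ℕ}
    (g : Koszul R n (p + 1) →ₗ[R] N) (hg : g ∘ₗ koszulD x (p + 1) = 0) {r : R}
    (hr : r ∈ Ideal.span (Set.range x)) :
    r • g ∈ LinearMap.range (LinearMap.lcomp R N (koszulD x p)) := by
  refine smul_mem_of_mem_span (LinearMap.range (LinearMap.lcomp R N (koszulD x p))) x g
    (fun i => ⟨g ∘ₗ koszulS R i p, ?_⟩) hr
  change (g ∘ₗ koszulS R i p) ∘ₗ koszulD x p = x i • g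
  nth_rw 2 [← LinearMap.comp_id g]
  rw [← LinearMap.comp_smul, ← koszulD_koszulS, LinearMap.comp_add,
    ← LinearMap.comp_assoc, hg, LinearMap.zero_comp, zero_add, LinearMap.comp_assoc]

/-- The Koszul cohomology with coefficients in `N` vanishes below the length of an `N`-regular
sequence in the radical of `(x₁, …, xₙ)`. -/
theorem koszul_cohomology_vanishing (rs : List R)
    (hpow : ∀ r ∈ rs, r ∈ (Ideal.span (Set.range x)).radical) :
    ∀ (N : Type*) [AddCommGroup N] [Module R N], IsWeaklyRegular N rs →
      (0 < rs.length → ∀ g : Koszul R n 0 →ₗ[R] N, g ∘ₗ koszulD x 0 = 0 → g = 0) ∧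
      ∀ p, p + 1 < rs.length → ∀ g : Koszul R n (p + 1) →ₗ[R] N, g ∘ₗ koszulD x (p + 1) = 0 →
        ∃ h : Koszul R n p →ₗ[R] N, h ∘ₗ koszulD x p = g := by
  induction rs with
  | nil => exact fun N _ _ _ => ⟨fun h => by simp at h, fun p h => by simp at h⟩
  | cons y rs ih =>
    intro N _ _ hreg
    rw [isWeaklyRegular_cons_iff] at hreg
    obtain ⟨hy, hrs⟩ := hreg
    obtain ⟨ih0, ih1⟩ := ih (fun r hr => hpow r (List.mem_cons_of_mem _ hr)) _ hrs
    obtain ⟨t, ht⟩ := hpow y List.mem_cons_self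
    have hyinj : ∀ {P : Type u} [AddCommGroup P] [Module R P] (f g : P →ₗ[R] N),
        y • f = y • g → f = g := fun f g h =>
      LinearMap.ext fun c => hy (by simpa using LinearMap.congr_fun h c)
    refine ⟨fun _ g hg => ?_, fun p hp g hg => ?_⟩
    · refine (Submodule.mem_bot R).1 (mem_of_pow_smul_mem
        (A := Koszul R n 0 →ₗ[R] N) ⊤ ⊥ y (fun g _ h => ?_) t g trivial
        ((Submodule.mem_bot R).2 (smul_koszul_cochain_zero x g hg ht)))
      rw [Submodule.mem_bot] at h ⊢
      exact hyinj g 0 (by rw [h, smul_zero])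
    · have hp' : p < rs.length := by simpa using hp
      suffices h : g ∈ LinearMap.range (LinearMap.lcomp R N (koszulD x p)) from h
      refine mem_of_pow_smul_mem (LinearMap.ker (LinearMap.lcomp R N (koszulD x (p + 1))))
        (LinearMap.range (LinearMap.lcomp R N (koszulD x p))) y ?_ t g hg
        (smul_koszul_cochain x g hg ht)
      -- It remains to see that y is injective on cohomology. If yg = h ∘ d, then h is a cocycle
      -- modulo y, hence a coboundary modulo y by induction. Lifting gives h = h'' + yh' with h'' ∘
      -- d = 0, so g = h' ∘ d.
      rintro g hg ⟨h, hh⟩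
      change h ∘ₗ koszulD x p = y • g at hh
      have key : ((y • (⊤ : Submodule R N)).mkQ ∘ₗ h) ∘ₗ koszulD x p = 0 := by
        rw [LinearMap.comp_assoc, hh]
        exact LinearMap.ext fun c => (Submodule.Quotient.mk_eq_zero _).2
          (Submodule.smul_mem_pointwise_smul (g c) y ⊤ trivial)
      have hdiv : ∃ h' h'' : Koszul R n p →ₗ[R] N, h'' ∘ₗ koszulD x p = 0 ∧ h - h'' = y • h' := by
        rcases p with - | p
        · obtain ⟨h', hh'⟩ := exists_smul_comp_of_mkQ_comp_eq_zero y h (ih0 hp' _ key)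
          exact ⟨h', 0, by simp, by simpa using hh'⟩
        · obtain ⟨e, he⟩ := ih1 p hp' _ key
          obtain ⟨e', he'⟩ := Module.projective_lifting_property
            (y • (⊤ : Submodule R N)).mkQ e (Submodule.mkQ_surjective _)
          obtain ⟨h', hh'⟩ := exists_smul_comp_of_mkQ_comp_eq_zero y (h - e' ∘ₗ koszulD x p) (by
            rw [LinearMap.comp_sub, ← LinearMap.comp_assoc, he', he, sub_self])
          exact ⟨h', e' ∘ₗ koszulD x p, by
            rw [LinearMap.comp_assoc, koszulD_comp_koszulD, LinearMap.comp_zero], hh'⟩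
      obtain ⟨h', h'', h0, h1⟩ := hdiv
      refine ⟨h', hyinj _ _ ?_⟩
      change y • (h' ∘ₗ koszulD x p) = y • g
      rw [← LinearMap.smul_comp, ← h1, LinearMap.sub_comp, h0, hh, sub_zero]

lemma smul_koszul_cycle {N : Type*} [AddCommGroup N] [Module R N] {p : ℕ}
    (c : N ⊗[R] Koszul R n (p + 1)) (hc : (koszulD x p).lTensor N c = 0) {r : R}
    (hr : r ∈ Ideal.span (Set.range x)) :
    r • c ∈ LinearMap.range ((koszulD x (p + 1)).lTensor N) := by
  refine smul_mem_of_mem_span (LinearMap.range ((koszulD x (p + 1)).lTensor N)) x c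
    (fun i => ⟨(koszulS R i (p + 1)).lTensor N c, ?_⟩) hr
  have h := LinearMap.congr_fun (congrArg (LinearMap.lTensor N) (koszulD_koszulS x i p)) c
  rwa [LinearMap.lTensor_add, LinearMap.lTensor_comp, LinearMap.lTensor_comp, LinearMap.add_apply,
    LinearMap.comp_apply, LinearMap.comp_apply, hc, map_zero, add_zero, LinearMap.lTensor_smul,
    LinearMap.lTensor_id, LinearMap.smul_apply, LinearMap.id_apply] at h

/-- The Koszul homology with coefficients in `N` vanishes in degrees `> n - m`, for `m` the length
of an `N`-regular sequence in the radical of `(x₁, …, xₙ)`. -/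
theorem koszul_homology_vanishing (rs : List R)
    (hpow : ∀ r ∈ rs, r ∈ (Ideal.span (Set.range x)).radical) :
    ∀ (N : Type*) [AddCommGroup N] [Module R N], IsWeaklyRegular N rs →
      ∀ p, n < p + 1 + rs.length →
        Function.Exact ((koszulD x (p + 1)).lTensor N) ((koszulD x p).lTensor N) := by
  have hcomp : ∀ (N : Type _) [AddCommGroup N] [Module R N] p c,
      (koszulD x p).lTensor N ((koszulD x (p + 1)).lTensor N c) = 0 := fun N _ _ p c => by
    rw [← LinearMap.comp_apply, ← LinearMap.lTensor_comp, koszulD_comp_koszulD,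
      LinearMap.lTensor_zero, LinearMap.zero_apply]
  induction rs with
  | nil =>
    intro N _ _ _ p hp
    have := subsingleton_koszul (R := R) (n := n) (p := p + 1) (by simpa using hp)
    have : Subsingleton (N ⊗[R] Koszul R n (p + 1)) := inferInstance
    exact fun c => ⟨fun _ => ⟨0, Subsingleton.elim _ _⟩, fun _ => by
      rw [Subsingleton.elim c 0, map_zero]⟩
  | cons y rs ih =>
    intro N _ _ hreg p hp
    rw [isWeaklyRegular_cons_iff] at hreg
    obtain ⟨hy, hrs⟩ := hreg
    -- The sequence on N/yN is shorter by one, so exactness there is available one degree higher,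
    -- which is where it is needed.
    have ih1 := ih (fun r hr => hpow r (List.mem_cons_of_mem _ hr)) _ hrs (p + 1)
      (by simp at hp; omega)
    obtain ⟨t, ht⟩ := hpow y List.mem_cons_self
    refine fun c => ⟨fun hc => ?_, ?_⟩
    swap
    · rintro ⟨d, rfl⟩; exact hcomp N p d
    refine mem_of_pow_smul_mem (LinearMap.ker ((koszulD x p).lTensor N))
        (LinearMap.range ((koszulD x (p + 1)).lTensor N)) y ?_ t c hc
        (smul_koszul_cycle x c hc ht)
    -- If yc = ∂d, then d is a cycle modulo y, so d - ∂e = yf for some e and f. Applying ∂ gives y∂f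
    -- = yc, and y is a nonzerodivisor on N ⊗ K because K is flat.
    rintro c hc ⟨d, hd⟩
    let π := (y • (⊤ : Submodule R N)).mkQ
    have hπ : ∀ q (e : N ⊗[R] Koszul R n (q + 1)), (koszulD x q).lTensor _
        (π.rTensor _ e) = π.rTensor _ ((koszulD x q).lTensor N e) := fun q e => by
      rw [← LinearMap.comp_apply, ← LinearMap.comp_apply, LinearMap.lTensor_comp_rTensor,
        LinearMap.rTensor_comp_lTensor]
    have hex : Function.Exact (LinearMap.lsmul R N y) π := fun z => by
      rw [Submodule.mkQ_apply, Submodule.Quotient.mk_eq_zero,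
        Submodule.mem_smul_pointwise_iff_exists]
      simp
    have hys : ∀ q (e : N ⊗[R] Koszul R n q), (LinearMap.lsmul R N y).rTensor _ e = y • e :=
      fun q e => by
        have : LinearMap.lsmul R N y = y • LinearMap.id := rfl
        rw [this, LinearMap.rTensor_smul, LinearMap.rTensor_id]; rfl
    have hexT : ∀ q, Function.Exact ((LinearMap.lsmul R N y).rTensor (Koszul R n q))
        (π.rTensor _) := fun q => rTensor_exact _ hex (Submodule.mkQ_surjective _)
    have hinj : Function.Injective ((LinearMap.lsmul R N y).rTensor (Koszul R n (p + 1))) :=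
      Module.Flat.rTensor_preserves_injective_linearMap _ hy
    have h1 : (koszulD x (p + 1)).lTensor _ (π.rTensor _ d) = 0 := by
      rw [hπ, hd, ← hys]; exact (hexT _).apply_apply_eq_zero c
    obtain ⟨e, he⟩ := (ih1 _).1 h1
    obtain ⟨e, rfl⟩ := LinearMap.rTensor_surjective (Koszul R n (p + 1 + 1 + 1))
      (Submodule.mkQ_surjective (y • (⊤ : Submodule R N))) e
    have h2 : π.rTensor _ (d - (koszulD x (p + 1 + 1)).lTensor N e) = 0 := by
      rw [map_sub, ← hπ, sub_eq_zero]; exact he.symm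
    obtain ⟨f, hf⟩ := (hexT _ _).1 h2
    refine ⟨f, hinj ?_⟩
    rw [hys, hys, ← map_smul, ← hys, hf, map_sub, hcomp, sub_zero, hd]

variable [IsLocalRing R] {x}

/-- A regular sequence of length dim R = n stays weakly regular on a free module by flatness. Since
𝔪 is the radical of Q, any such sequence serves, and regularity of x₁, …, xₙ itself is never needed.
-/
lemma exists_isWeaklyRegular (hR : IsCohenMacaulayLocal R)
    (hx : IsSystemOfParameters x) (N : Type*) [AddCommGroup N] [Module R N] [Module.Free R N] :
    ∃ rs : List R, rs.length = n ∧ (∀ r ∈ rs, r ∈ (Ideal.span (Set.range x)).radical) ∧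
      IsWeaklyRegular N rs := by
  obtain ⟨rs, hm, hreg, hdim⟩ := hR.exists_regular
  refine ⟨rs, ?_, fun r hr => hx.radical_eq ▸ hm r hr, ?_⟩
  · have := hx.dim_eq.symm.trans hdim
    exact_mod_cast this.symm
  · have := hreg.toIsWeaklyRegular.isWeaklyRegular_lTensor (M₂ := N)
    exact ((TensorProduct.rid R N).isWeaklyRegular_congr rs).1 this

lemma koszul_cochain_zero (hR : IsCohenMacaulayLocal R) (hx : IsSystemOfParameters x) (hn : 0 < n)
    {N : Type*} [AddCommGroup N] [Module R N] [Module.Free R N]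
    {g : Koszul R n 0 →ₗ[R] N} (hg : g ∘ₗ koszulD x 0 = 0) : g = 0 := by
  obtain ⟨rs, hl, hpow, hreg⟩ := exists_isWeaklyRegular hR hx N
  exact (koszul_cohomology_vanishing x rs hpow N hreg).1 (hl ▸ hn) g hg

lemma exists_koszul_coboundary (hR : IsCohenMacaulayLocal R) (hx : IsSystemOfParameters x)
    {N : Type*} [AddCommGroup N] [Module R N] [Module.Free R N] {p : ℕ} (hp : p + 1 < n)
    {g : Koszul R n (p + 1) →ₗ[R] N} (hg : g ∘ₗ koszulD x (p + 1) = 0) :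
    ∃ h : Koszul R n p →ₗ[R] N, h ∘ₗ koszulD x p = g := by
  obtain ⟨rs, hl, hpow, hreg⟩ := exists_isWeaklyRegular hR hx N
  exact (koszul_cohomology_vanishing x rs hpow N hreg).2 p (hl ▸ hp) g hg

lemma koszul_tensor_exact (hR : IsCohenMacaulayLocal R) (hx : IsSystemOfParameters x)
    (N : Type*) [AddCommGroup N] [Module R N] [Module.Free R N] (p : ℕ) :
    Function.Exact ((koszulD x (p + 1)).lTensor N) ((koszulD x p).lTensor N) := by
  obtain ⟨rs, hl, hpow, hreg⟩ := exists_isWeaklyRegular hR hx N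
  exact koszul_homology_vanishing x rs hpow N hreg p (by omega)

end DepthSensitivity

/-! ### Construction of the chain map σ. -/

section Comparison

variable {R : Type u} [CommRing R] {k : ℕ}

lemma eq_fullSet {n : ℕ} (I : Set.powersetCard (Fin n) n) : I = fullSet n := by
  have h1 : (I : Finset (Fin n)).card = n := I.2
  exact Subtype.ext (Finset.eq_univ_of_card _ (by rw [h1, Fintype.card_fin]))

lemma coSingleton_bijective (n : ℕ) : Function.Bijective (coSingleton (n := n)) := by
  rw [Fintype.bijective_iff_injective_and_card]
  refine ⟨fun i j h => ?_, ?_⟩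
  · have h' : Finset.univ.erase i = Finset.univ.erase j := congrArg Subtype.val h
    by_contra hij
    have : i ∈ Finset.univ.erase j := by simp [hij]
    rw [← h'] at this
    simp at this
  · rw [← Nat.card_eq_fintype_card (α := Set.powersetCard (Fin (n + 1)) n), Set.powersetCard.card]
    simp

/-- The bijection `i ↦ N ∖ {i}`. -/
noncomputable def coSingletonEquiv (n : ℕ) : Fin (n + 1) ≃ Set.powersetCard (Fin (n + 1)) n :=
  Equiv.ofBijective _ (coSingleton_bijective n)

lemma koszulD_fullSet (x : Fin (k + 1) → R) :
    koszulD x k (koszulE R (fullSet (k + 1))) =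
      ∑ i : Fin (k + 1), ((-1) ^ (i : ℕ) * x i) • koszulE R (coSingleton i) := by
  rw [koszulD_koszulE]
  refine Fintype.sum_equiv (Equiv.subtypeUnivEquiv fun i => Finset.mem_univ i) _ _ fun i => ?_
  have : koszulSign R (i : Fin (k + 1)) (fullSet (k + 1) : Finset (Fin (k + 1))) =
      (-1) ^ ((i : Fin (k + 1)) : ℕ) := by
    change (-1 : R) ^ (Finset.univ.filter (· < (i : Fin (k + 1)))).card = _
    rw [show Finset.univ.filter (· < (i : Fin (k + 1))) = Finset.Iio (i : Fin (k + 1)) by ext; simp,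
      Fin.card_Iio]
  rw [this]
  rfl

variable {F : ℕ → Type u} [∀ p, AddCommGroup (F p)] [∀ p, Module R (F p)]
  {x : Fin (k + 2) → R} {φ : ∀ p, F (p + 1) →ₗ[R] F p}

/-- The map is extended downwards: φ_m ∘ τ_{m+1} is a cocycle in Hom(K, F_m) of degree m + 1 < n,
hence factors through the Koszul differential, and the factor is τ_m. -/
lemma exists_koszul_chain_map [IsLocalRing R] (hR : IsCohenMacaulayLocal R)
    (hx : IsSystemOfParameters x) (hF : IsAcyclicFreeComplex (k + 2) F φ)
    (s₁ : Koszul R (k + 2) (k + 1) →ₗ[R] F (k + 1)) (s₂ : Koszul R (k + 2) (k + 2) →ₗ[R] F (k + 2))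
    (hs : φ (k + 1) ∘ₗ s₂ = s₁ ∘ₗ koszulD x (k + 1)) :
    ∃ τ : ∀ p, Koszul R (k + 2) p →ₗ[R] F p, τ (k + 1) = s₁ ∧ τ (k + 2) = s₂ ∧
      ∀ p, φ p ∘ₗ τ (p + 1) = τ p ∘ₗ koszulD x p := by
  suffices h : ∀ j m, m + j = k + 1 → ∃ τ : ∀ p, Koszul R (k + 2) p →ₗ[R] F p,
      τ (k + 1) = s₁ ∧ τ (k + 2) = s₂ ∧ ∀ p, m ≤ p → φ p ∘ₗ τ (p + 1) = τ p ∘ₗ koszulD x p by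
    obtain ⟨τ, h1, h2, h3⟩ := h (k + 1) 0 (by omega)
    exact ⟨τ, h1, h2, fun p => h3 p (Nat.zero_le p)⟩
  intro j
  induction j with
  | zero =>
    intro m hm
    obtain rfl : m = k + 1 := hm
    -- The zeros below degree k + 1 are placeholders overwritten by the induction; above degree k +
    -- 2 the Koszul modules vanish.
    let τ : ∀ p, Koszul R (k + 2) p →ₗ[R] F p :=
      Function.update (Function.update (fun _ => 0) (k + 1) s₁) (k + 2) s₂
    have h1 : τ (k + 1) = s₁ := by
      simp only [τ]
      rw [Function.update_of_ne (by omega), Function.update_self]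
    have h2 : τ (k + 2) = s₂ := Function.update_self ..
    refine ⟨τ, h1, h2, fun p hp => ?_⟩
    obtain rfl | hp' := hp.eq_or_lt
    · rw [h1, h2, hs]
    · have := subsingleton_koszul (R := R) (n := k + 2) (p := p + 1) (by omega)
      exact LinearMap.ext fun c => by rw [Subsingleton.elim c 0, map_zero, map_zero]
  | succ j ih =>
    intro m hm
    obtain ⟨τ, h1, h2, h3⟩ := ih (m + 1) (by omega)
    have := hF.free m
    obtain ⟨h, hh⟩ := exists_koszul_coboundary hR hx (p := m) (by omega)
      (g := φ m ∘ₗ τ (m + 1)) (by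
        rw [LinearMap.comp_assoc, ← h3 (m + 1) le_rfl, ← LinearMap.comp_assoc,
          (hF.exact m).linearMap_comp_eq_zero, LinearMap.zero_comp])
    refine ⟨Function.update τ m h, ?_, ?_, fun p hp => ?_⟩
    · rw [Function.update_of_ne (by omega), h1]
    · rw [Function.update_of_ne (by omega), h2]
    · rw [Function.update_of_ne (by omega)]
      obtain rfl | hp' := hp.eq_or_lt
      · rw [Function.update_self, hh]
      · rw [Function.update_of_ne (by omega), h3 p hp']

variable {Λ : Type*} {v : Module.Basis Λ R (F (k + 2))} {w : Λ × Fin (k + 2) → F (k + 1)}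

lemma exists_isComparison [IsLocalRing R] (hR : IsCohenMacaulayLocal R)
    (hx : IsSystemOfParameters x) (hF : IsAcyclicFreeComplex (k + 2) F φ)
    (hw : ∀ l, φ (k + 1) (v l) = ∑ i, x i • w (l, i)) :
    ∃ σ : ∀ p, TensorK R k F p →ₗ[R] F p, IsComparison x φ v w σ := by
  let s₁ (l : Λ) : Koszul R (k + 2) (k + 1) →ₗ[R] F (k + 1) := Finsupp.linearCombination R fun I =>
    (-1 : R) ^ (k + 2 + ((coSingletonEquiv (k + 1)).symm I : ℕ)) •
      w (l, (coSingletonEquiv (k + 1)).symm I)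
  let s₂ (l : Λ) : Koszul R (k + 2) (k + 2) →ₗ[R] F (k + 2) :=
    Finsupp.linearCombination R fun _ => (-1 : R) ^ (k + 2) • v l
  have h₁ : ∀ l i, s₁ l (koszulE R (coSingleton i)) = (-1 : R) ^ (k + 2 + (i : ℕ)) • w (l, i) := by
    intro l i
    have : (coSingletonEquiv (k + 1)).symm (coSingleton i) = i :=
      (coSingletonEquiv (k + 1)).symm_apply_apply i
    simp [s₁, koszulE, this]
  have h₂ : ∀ l I, s₂ l (koszulE R I) = (-1 : R) ^ (k + 2) • v l := by simp [s₂, koszulE]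
  have hs : ∀ l, φ (k + 1) ∘ₗ s₂ l = s₁ l ∘ₗ koszulD x (k + 1) := by
    refine fun l => koszul_hom_ext fun I => ?_
    rw [eq_fullSet I, LinearMap.comp_apply, LinearMap.comp_apply, h₂, koszulD_fullSet, map_smul, hw,
      map_sum, Finset.smul_sum]
    refine Finset.sum_congr rfl fun i _ => ?_
    rw [map_smul, h₁, smul_smul, smul_smul]
    congr 1
    have : ((-1 : R) ^ (i : ℕ)) * (-1) ^ (i : ℕ) = 1 := by rw [← mul_pow]; simp
    rw [pow_add _ (k + 2)]
    linear_combination -(-1) ^ (k + 2) * x i * this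
  -- F_n ⊗ K is a direct sum of copies of K indexed by the basis `v`, so σ is assembled from one
  -- chain map for each basis element.
  choose τ hτ₁ hτ₂ hτ using fun l => exists_koszul_chain_map hR hx hF (s₁ l) (s₂ l) (hs l)
  have hl : ∀ p l c, TensorProduct.lift (v.constr R fun l => τ l p) (v l ⊗ₜ c) = τ l p c := by
    intro p l c
    rw [TensorProduct.lift.tmul, Module.Basis.constr_basis]
  refine ⟨fun p => TensorProduct.lift (v.constr R fun l => τ l p), ?_, ?_, ?_⟩
  · intro p
    refine TensorProduct.ext (v.ext fun l => LinearMap.ext fun c => ?_)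
    have := LinearMap.congr_fun (hτ l p) c
    change φ p (TensorProduct.lift _ (v l ⊗ₜ c)) = TensorProduct.lift _ (v l ⊗ₜ koszulD x p c)
    rw [hl, hl]
    exact this
  · intro l i
    rw [hl, hτ₁, h₁]
  · intro l
    rw [hl, hτ₂, h₂]

end Comparison

/-! ### The induced map F_n/QF_n → (M : Q)/M is bijective. -/

section Colon

variable {R : Type u} [CommRing R] {k : ℕ}
  {F : ℕ → Type u} [∀ p, AddCommGroup (F p)] [∀ p, Module R (F p)]
  {x : Fin (k + 2) → R} {φ : ∀ p, F (p + 1) →ₗ[R] F p}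
  {Λ : Type*} {v : Module.Basis Λ R (F (k + 2))} {w : Λ × Fin (k + 2) → F (k + 1)}
  {σ : ∀ p, TensorK R k F p →ₗ[R] F p}

namespace IsComparison

lemma comm_mk (hσ : IsComparison x φ v w σ) (f : F (k + 2)) (p : ℕ) :
    φ p ∘ₗ (σ (p + 1) ∘ₗ TensorProduct.mk R _ _ f) =
      (σ p ∘ₗ TensorProduct.mk R _ _ f) ∘ₗ koszulD x p :=
  LinearMap.ext fun c => LinearMap.congr_fun (hσ.comm p) (f ⊗ₜ c)

lemma top_tmul (hσ : IsComparison x φ v w σ) (f : F (k + 2)) (I) :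
    σ (k + 2) (f ⊗ₜ[R] koszulE R I) = (-1 : R) ^ (k + 2) • f := by
  rw [eq_fullSet I]
  have : σ (k + 2) ∘ₗ (TensorProduct.mk R _ _).flip (koszulE R (fullSet (k + 2))) =
      (-1 : R) ^ (k + 2) • LinearMap.id := v.ext fun l => hσ.top l
  exact LinearMap.congr_fun this f

/-- A map `K_p → F_p` which is a chain map up to a boundary is homotopic to one of the form
`σ_p (f ⊗ -)`. -/
lemma exists_homotopy [IsLocalRing R] (hR : IsCohenMacaulayLocal R)
    (hx : IsSystemOfParameters x) (hF : IsAcyclicFreeComplex (k + 2) F φ)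
    (hσ : IsComparison x φ v w σ) (j : ℕ) : ∀ p, p + j = k + 1 →
    ∀ τ : Koszul R (k + 2) p →ₗ[R] F p, LinearMap.range (τ ∘ₗ koszulD x p) ≤ LinearMap.range (φ p) →
    ∃ f : F (k + 2), ∃ s : Koszul R (k + 2) p →ₗ[R] F (p + 1),
      (τ - σ p ∘ₗ TensorProduct.mk R _ _ f - φ p ∘ₗ s) ∘ₗ koszulD x p = 0 := by
  induction j with
  | zero =>
    rintro p hp τ hτ
    obtain rfl : p = k + 1 := hp
    obtain ⟨τ', hτ'⟩ := exists_comp_eq_of_range_le _ _ hτ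
    -- K_n has rank one, so τ' is determined by its value at e_N; the sign undoes that of σ_n.
    refine ⟨(-1 : R) ^ (k + 2) • τ' (koszulE R (fullSet (k + 2))), 0, ?_⟩
    rw [LinearMap.comp_zero, sub_zero, LinearMap.sub_comp, ← hτ', ← hσ.comm_mk, sub_eq_zero]
    congr 1
    refine koszul_hom_ext fun I => ?_
    rw [LinearMap.comp_apply, TensorProduct.mk_apply]
    refine Eq.trans ?_ (hσ.top_tmul _ _).symm
    rw [eq_fullSet I, smul_smul, ← mul_pow]
    simp
  | succ j ih =>
    intro p hp τ hτ
    obtain ⟨τ', hτ'⟩ := exists_comp_eq_of_range_le _ _ hτ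
    -- The induction goes from degree p + 1 down to p: the lift τ' of τ ∘ d satisfies the hypothesis
    -- one degree up, and the resulting cocycle is a coboundary h ∘ d, with h the new homotopy.
    obtain ⟨f, s, hs⟩ := ih (p + 1) (by omega) τ' (by
      rw [← (hF.exact p).linearMap_ker_eq]
      rintro _ ⟨c, rfl⟩
      rw [LinearMap.mem_ker, ← LinearMap.comp_apply, ← LinearMap.comp_assoc, hτ',
        LinearMap.comp_assoc, koszulD_comp_koszulD, LinearMap.comp_zero, LinearMap.zero_apply])
    have := hF.free (p + 1)
    obtain ⟨h, hh⟩ := exists_koszul_coboundary hR hx (by omega) hs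
    refine ⟨f, h, ?_⟩
    rw [LinearMap.sub_comp, LinearMap.sub_comp, ← hτ', LinearMap.comp_assoc _ h, hh,
      LinearMap.comp_sub, LinearMap.comp_sub, ← hσ.comm_mk, ← LinearMap.comp_assoc s (φ (p + 1)),
      (hF.exact p).linearMap_comp_eq_zero, LinearMap.zero_comp, sub_zero, sub_self]

/-- The map e_∅ ↦ z carries boundaries into M because Qz ⊆ M. After subtracting σ_0(f ⊗ -) and a map
into M it becomes a 0-cocycle of Hom(K, F_0), which is zero. -/
lemma exists_of_mem_colon [IsLocalRing R] (hR : IsCohenMacaulayLocal R)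
    (hx : IsSystemOfParameters x) (hF : IsAcyclicFreeComplex (k + 2) F φ)
    (hσ : IsComparison x φ v w σ) {z : F 0}
    (hz : z ∈ moduleColon (LinearMap.range (φ 0)) (Ideal.span (Set.range x))) :
    ∃ ξ η, z = σ 0 ξ + φ 0 η := by
  let e : Set.powersetCard (Fin (k + 2)) 0 := ⟨∅, Finset.card_empty⟩
  let τ : Koszul R (k + 2) 0 →ₗ[R] F 0 := Finsupp.linearCombination R fun _ => z
  have hτ : ∀ c, τ c ∈ moduleColon (LinearMap.range (φ 0)) (Ideal.span (Set.range x)) := by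
    intro c
    have hc : τ c ∈ LinearMap.range τ := ⟨c, rfl⟩
    rw [Finsupp.range_linearCombination] at hc
    refine Submodule.span_le.2 ?_ hc
    rintro _ ⟨_, rfl⟩
    exact hz
  obtain ⟨f, s, hs⟩ := hσ.exists_homotopy hR hx hF (k + 1) 0 (by omega) τ (by
    rintro _ ⟨c, rfl⟩
    rw [LinearMap.comp_apply]
    refine Submodule.smul_induction_on (koszulD_mem x c) (fun q hq d _ => ?_) fun a b ha hb => ?_
    · rw [map_smul]
      exact hτ d q hq
    · rw [map_add]
      exact add_mem ha hb)
  have := hF.free 0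
  have h0 := koszul_cochain_zero hR hx (by omega) hs
  refine ⟨f ⊗ₜ koszulE R e, s (koszulE R e), ?_⟩
  have h1 := LinearMap.congr_fun h0 (koszulE R e)
  have h2 : τ (koszulE R e) = z := by simp [τ, koszulE]
  rw [LinearMap.sub_apply, LinearMap.sub_apply, h2, LinearMap.zero_apply, sub_sub, sub_eq_zero] at h1
  exact h1

lemma eq_smul_koszulE {n p : ℕ} {I : Set.powersetCard (Fin n) p} (hI : ∀ J, J = I)
    (c : Koszul R n p) : c = c I • koszulE R I := by
  ext J
  rw [hI J]
  simp [koszulE]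

lemma eq_emptySet {n : ℕ} (I : Set.powersetCard (Fin n) 0) : I = ⟨∅, Finset.card_empty⟩ :=
  Subtype.ext (Finset.card_eq_zero.1 I.2)

lemma exists_eq_tmul {p : ℕ} {I : Set.powersetCard (Fin (k + 2)) p} (hI : ∀ J, J = I)
    (ξ : TensorK R k F p) : ∃ f : F (k + 2), ξ = f ⊗ₜ[R] koszulE R I := by
  induction ξ using TensorProduct.induction_on with
  | zero => exact ⟨0, by rw [TensorProduct.zero_tmul]⟩
  | add a b ha hb =>
    obtain ⟨f, rfl⟩ := ha
    obtain ⟨g, rfl⟩ := hb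
    exact ⟨f + g, by rw [TensorProduct.add_tmul]⟩
  | tmul f c =>
    exact ⟨c I • f, by rw [TensorProduct.smul_tmul, ← eq_smul_koszulE hI]⟩

lemma smul_tmul_mem_range (f : F (k + 2)) (c : Koszul R (k + 2) 0) {r : R}
    (hr : r ∈ Ideal.span (Set.range x)) : r • (f ⊗ₜ[R] c) ∈ LinearMap.range (tensorD F x 0) := by
  refine smul_mem_of_mem_span (LinearMap.range (tensorD F x 0)) x (f ⊗ₜ[R] c)
    (fun i => ⟨f ⊗ₜ koszulS R i 0 c, ?_⟩) hr
  have := LinearMap.congr_fun (koszulD_koszulS_zero x i) c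
  rw [LinearMap.comp_apply] at this
  rw [tensorD, LinearMap.lTensor_tmul, this, LinearMap.smul_apply, LinearMap.id_apply,
    TensorProduct.tmul_smul]

lemma map_mem_colon (hσ : IsComparison x φ v w σ) (ξ : TensorK R k F 0) :
    σ 0 ξ ∈ moduleColon (LinearMap.range (φ 0)) (Ideal.span (Set.range x)) := by
  intro q hq
  obtain ⟨f, rfl⟩ := exists_eq_tmul eq_emptySet ξ
  obtain ⟨ζ, hζ⟩ := smul_tmul_mem_range f (koszulE R ⟨∅, Finset.card_empty⟩) hq
  rw [← map_smul, ← hζ]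
  exact ⟨σ 1 ζ, LinearMap.congr_fun (hσ.comm 0) ζ⟩

/-- The usual upward construction, with K free and F acyclic. Carrying two consecutive components at
once makes the homotopy identity itself the induction step. -/
lemma exists_null_homotopy (hF : IsAcyclicFreeComplex (k + 2) F φ)
    (hσ : IsComparison x φ v w σ) (f : F (k + 2))
    (hf : ∀ c, σ 0 (f ⊗ₜ c) ∈ LinearMap.range (φ 0)) (p : ℕ) :
    ∃ s : Koszul R (k + 2) p →ₗ[R] F (p + 1),
      (σ p ∘ₗ TensorProduct.mk R _ _ f - φ p ∘ₗ s) ∘ₗ koszulD x p = 0 ∧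
      ∃ s' : Koszul R (k + 2) (p + 1) →ₗ[R] F (p + 1 + 1),
        φ (p + 1) ∘ₗ s' = σ (p + 1) ∘ₗ TensorProduct.mk R _ _ f - s ∘ₗ koszulD x p := by
  have key : ∀ (p : ℕ) (s : Koszul R (k + 2) p →ₗ[R] F (p + 1)),
      (σ p ∘ₗ TensorProduct.mk R _ _ f - φ p ∘ₗ s) ∘ₗ koszulD x p = 0 →
      ∃ s' : Koszul R (k + 2) (p + 1) →ₗ[R] F (p + 1 + 1),
        φ (p + 1) ∘ₗ s' = σ (p + 1) ∘ₗ TensorProduct.mk R _ _ f - s ∘ₗ koszulD x p := by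
    intro p s hs
    refine exists_comp_eq_of_range_le _ _ ?_
    rw [← (hF.exact p).linearMap_ker_eq, LinearMap.range_le_ker_iff, LinearMap.comp_sub,
      hσ.comm_mk, ← LinearMap.comp_assoc, ← LinearMap.sub_comp, hs]
  induction p with
  | zero =>
    obtain ⟨s, hs⟩ := exists_comp_eq_of_range_le (φ 0) (σ 0 ∘ₗ TensorProduct.mk R _ _ f) (by
      rintro _ ⟨c, rfl⟩
      exact hf c)
    have h0 : (σ 0 ∘ₗ TensorProduct.mk R _ _ f - φ 0 ∘ₗ s) ∘ₗ koszulD x 0 = 0 := by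
      rw [hs, sub_self, LinearMap.zero_comp]
    exact ⟨s, h0, key 0 s h0⟩
  | succ p ih =>
    obtain ⟨s, hs, s', hs'⟩ := ih
    have h0 : (σ (p + 1) ∘ₗ TensorProduct.mk R _ _ f - φ (p + 1) ∘ₗ s') ∘ₗ koszulD x (p + 1) = 0 := by
      rw [hs', sub_sub_cancel, LinearMap.comp_assoc, koszulD_comp_koszulD, LinearMap.comp_zero]
    exact ⟨s', h0, key (p + 1) s' h0⟩

lemma mem_range_of_map_mem (hF : IsAcyclicFreeComplex (k + 2) F φ)
    (hσ : IsComparison x φ v w σ) {ξ : TensorK R k F 0} (hξ : σ 0 ξ ∈ LinearMap.range (φ 0)) :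
    ξ ∈ LinearMap.range (tensorD F x 0) := by
  obtain ⟨f, rfl⟩ := exists_eq_tmul eq_emptySet ξ
  have hf : ∀ c, σ 0 (f ⊗ₜ c) ∈ LinearMap.range (φ 0) := by
    intro c
    rw [eq_smul_koszulE eq_emptySet c, TensorProduct.tmul_smul, map_smul]
    exact Submodule.smul_mem _ _ hξ
  -- In top degree `s'` takes values in F_{n+1} = 0, so ±f = s(∂e_N), which lies in QF_n.
  obtain ⟨s, -, s', hs'⟩ := hσ.exists_null_homotopy hF f hf (k + 1)
  have := hF.length (k + 1 + 1 + 1) (by omega)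
  have h0 : σ (k + 2) ∘ₗ TensorProduct.mk R _ _ f = s ∘ₗ koszulD x (k + 1) := by
    rw [← sub_eq_zero, ← hs', Subsingleton.elim s' 0, LinearMap.comp_zero]
  have h1 := LinearMap.congr_fun h0 (koszulE R (fullSet (k + 2)))
  have h2 : (-1 : R) ^ (k + 2) • f = s (koszulD x (k + 1) (koszulE R (fullSet (k + 2)))) := by
    rw [← hσ.top_tmul f (fullSet (k + 2))]; exact h1
  have hfQ : f ∈ Ideal.span (Set.range x) • (⊤ : Submodule R (F (k + 2))) := by
    have h3 : (-1 : R) ^ (k + 2) • f ∈ Ideal.span (Set.range x) • (⊤ : Submodule R (F (k + 2))) := by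
      rw [h2]
      have := Submodule.mem_map_of_mem (f := s) (koszulD_mem x (koszulE R (fullSet (k + 2))))
      rw [Submodule.map_smul''] at this
      exact Submodule.smul_mono le_rfl le_top this
    have h4 := Submodule.smul_mem _ ((-1 : R) ^ (k + 2)) h3
    rwa [smul_smul, ← mul_pow, neg_one_mul, neg_neg, one_pow, one_smul] at h4
  refine Submodule.smul_induction_on (p := fun f => f ⊗ₜ[R] koszulE R ⟨∅, Finset.card_empty⟩ ∈
    LinearMap.range (tensorD F x 0)) hfQ (fun q hq m _ => ?_) fun a b ha hb => ?_
  · rw [← TensorProduct.smul_tmul']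
    exact smul_tmul_mem_range _ _ hq
  · rw [TensorProduct.add_tmul]
    exact add_mem ha hb

end IsComparison

end Colon

/-! ### Mapping cones. -/

section Cone

variable {R : Type u} [CommRing R] {G F : ℕ → Type u}
    [∀ p, AddCommGroup (G p)] [∀ p, AddCommGroup (F p)] [∀ p, Module R (G p)]
    [∀ p, Module R (F p)] {d : ∀ p, G (p + 1) →ₗ[R] G p} {φ : ∀ p, F (p + 1) →ₗ[R] F p}
    {σ : ∀ p, G p →ₗ[R] F p}

lemma coneD_zero_apply (g : G 0) (f : F 1) : coneD d φ σ 0 (g, f) = σ 0 g + φ 0 f := rfl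

lemma coneD_succ_apply (p : ℕ) (g : G (p + 1)) (f : F (p + 2)) :
    coneD d φ σ (p + 1) (g, f) = (d p g, (-1 : R) ^ (p + 1) • σ (p + 1) g + φ (p + 1) f) := rfl

lemma coneD_coneD (hd : ∀ p c, d p (d (p + 1) c) = 0) (hφ : ∀ p c, φ p (φ (p + 1) c) = 0)
    (hσ : ∀ p c, φ p (σ (p + 1) c) = σ p (d p c)) (p : ℕ) (c : Cone G F (p + 2)) :
    coneD d φ σ p (coneD d φ σ (p + 1) c) = 0 := by
  obtain ⟨g, f⟩ := c
  cases p with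
  | zero =>
    rw [coneD_succ_apply, coneD_zero_apply, map_add, map_smul, hσ, hφ]
    simp
  | succ p =>
    rw [coneD_succ_apply, coneD_succ_apply, map_add, map_smul, hσ, hφ, hd]
    refine Prod.ext rfl ?_
    simp [pow_succ]

/-- Once the first coordinate is lifted, the error in the second is a cycle of F, hence a boundary.
Acyclicity of the cone is thus a question about the first coordinate only. -/
lemma exists_coneD_eq (hφ : ∀ p, Function.Exact (φ (p + 1)) (φ p))
    (hσ : ∀ p c, φ p (σ (p + 1) c) = σ p (d p c)) (p : ℕ) {g : G p} {f : F (p + 1)}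
    (hgf : coneD d φ σ p (g, f) = 0) {g' : G (p + 1)} (hg' : d p g' = g) :
    ∃ f' : F (p + 2), coneD d φ σ (p + 1) (g', f') = (g, f) := by
  have h : φ p (f - (-1 : R) ^ (p + 1) • σ (p + 1) g') = 0 := by
    rw [map_sub, map_smul, hσ, hg']
    cases p with
    | zero =>
      rw [coneD_zero_apply] at hgf
      rw [← hgf]; simp [add_comm]
    | succ p =>
      rw [coneD_succ_apply] at hgf
      have := congrArg Prod.snd hgf
      simp only at this
      rw [pow_succ _ (p + 1), mul_neg_one, neg_smul, sub_neg_eq_add]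
      exact (add_comm _ _).trans this
  obtain ⟨f', hf'⟩ := (hφ p _).1 h
  exact ⟨f', by rw [coneD_succ_apply, hf', hg', add_sub_cancel]⟩

end Cone

/-! ### Choosing Λ', U and the coefficients a, b. -/

section Reduction

lemma linearMap_mem_of_mem_smul_top {R L : Type*} [CommRing R] [AddCommGroup L] [Module R L] (I : Ideal R)
    (f : L →ₗ[R] R) {z : L} (hz : z ∈ I • (⊤ : Submodule R L)) : f z ∈ I := by
  refine Submodule.smul_induction_on hz (fun r hr m _ => ?_) fun a b ha hb => ?_
  · rw [map_smul]; exact I.mul_mem_right _ hr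
  · rw [map_add]; exact add_mem ha hb

variable {R : Type u} [CommRing R] [IsLocalRing R]

open IsLocalRing Submodule in
/-- A maximal subfamily of `w` which is independent modulo `𝔪` extends to a basis. -/
lemma exists_basis_extending {L : Type*} [AddCommGroup L] [Module R L] [IsNoetherianRing R]
    [Module.Finite R L] [Module.Free R L] {ι : Type*} (w : ι → L) :
    ∃ (S : Set ι) (U : Finset L) (B : Module.Basis (S ⊕ U) R L),
      (∀ q : S, B (Sum.inl q) = w q) ∧ (∀ y : U, B (Sum.inr y) = y) ∧
      ∀ q, ∃ m ∈ span R (w '' S), w q - m ∈ maximalIdeal R • (⊤ : Submodule R L) := by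
  let f := TensorProduct.mk R (ResidueField R) L 1
  let V : ι ⊕ L → ResidueField R ⊗[R] L := f ∘ Sum.elim w id
  -- Independence over the residue field is exhausted among the w's first, and only then completed
  -- by arbitrary elements of L. The resulting basis of L/𝔪L lifts to L because L is free.
  obtain ⟨s, hs, -, hspan, hli⟩ := exists_linearIndepOn_extension (K := ResidueField R) (v := V)
    (linearIndepOn_empty _ V) (Set.empty_subset (Set.range Sum.inl))
  obtain ⟨b, -, hsb, hbspan, hbli⟩ := exists_linearIndepOn_extension hli (Set.subset_univ s)
  let S : Set ι := Sum.inl ⁻¹' b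
  let U : Set L := Sum.inr ⁻¹' b
  let fam : S ⊕ U → L := Sum.elim (fun q => w q) (fun y => (y : L))
  let e : S ⊕ U → b := Sum.elim (fun q => ⟨Sum.inl q.1, q.2⟩) (fun y => ⟨Sum.inr y.1, y.2⟩)
  have he : Function.Bijective e := by
    constructor
    · rintro (⟨a, ha⟩ | ⟨a, ha⟩) (⟨c, hc⟩ | ⟨c, hc⟩) h <;> simp [e] at h ⊢ <;> exact h
    · rintro ⟨a | a, ha⟩
      · exact ⟨Sum.inl ⟨a, ha⟩, rfl⟩
      · exact ⟨Sum.inr ⟨a, ha⟩, rfl⟩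
  have hfam : f ∘ fam = (fun i : b => V i) ∘ e := by
    ext (q | y) <;> rfl
  have hfsurj : Function.Surjective f :=
    TensorProduct.mk_surjective R L (ResidueField R) Ideal.Quotient.mk_surjective
  have := Module.finitePresentation_of_finite R L
  obtain ⟨B, hB⟩ := Module.exists_basis_of_basis_baseChange fam
    (by
      change LinearIndependent _ (f ∘ fam)
      rw [hfam]
      exact LinearIndependent.comp hbli e he.1)
    (by
      change span _ (Set.range (f ∘ fam)) = ⊤
      rw [hfam, he.2.range_comp, eq_top_iff]
      rintro z -
      obtain ⟨y, rfl⟩ := hfsurj z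
      have := hbspan ⟨Sum.inr y, trivial, rfl⟩
      rwa [Set.image_eq_range] at this)
    (Module.Flat.rTensor_preserves_injective_linearMap _ Subtype.val_injective)
  have hfin : Finite (S ⊕ U) := Module.Finite.finite_basis B
  have hU : Finite U := Finite.sum_right S
  replace hU : U.Finite := U.toFinite
  refine ⟨S, hU.toFinset, B.reindex (Equiv.sumCongr (Equiv.refl S)
    (Equiv.subtypeEquivRight fun y => hU.mem_toFinset.symm)), fun q => ?_, fun y => ?_, fun q => ?_⟩
  · simp [hB, fam]
  · simp [hB, fam]
  · have h1 : f (w q) ∈ span (ResidueField R) (V '' s) := hspan ⟨Sum.inl q, ⟨q, rfl⟩, rfl⟩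
    have h2 : V '' s ⊆ f '' (w '' S) := by
      rintro _ ⟨i, hi, rfl⟩
      obtain ⟨r, rfl⟩ := hs hi
      exact ⟨w r, ⟨r, hsb hi, rfl⟩, rfl⟩
    have h3 : f (w q) ∈ span R (f '' (w '' S)) := by
      rw [← Submodule.restrictScalars_span R (ResidueField R) Ideal.Quotient.mk_surjective]
      exact span_mono h2 h1
    rw [span_image] at h3
    obtain ⟨m, hm, hm'⟩ := h3
    refine ⟨m, hm, ?_⟩
    rw [← LinearMap.ker_tensorProductMk]
    change f (w q - m) = 0
    rw [map_sub, hm', sub_self]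

lemma exists_isReduction [IsNoetherianRing R] {k : ℕ} {F : ℕ → Type u}
    [∀ p, AddCommGroup (F p)] [∀ p, Module R (F p)] [Module.Finite R (F (k + 1))]
    [Module.Free R (F (k + 1))] {Λ : Type*} [Fintype Λ] (w : Λ × Fin (k + 2) → F (k + 1)) :
    ∃ (S : Set (Λ × Fin (k + 2))) (U : Finset (F (k + 1)))
      (a : Λ × Fin (k + 2) → Λ × Fin (k + 2) → R) (b : Λ × Fin (k + 2) → F (k + 1) → R),
      IsReduction w S U a b := by
  classical
  obtain ⟨S, U, B, hS, hU, hm⟩ := exists_basis_extending (R := R) w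
  have hB : (B : S ⊕ U → F (k + 1)) = Sum.elim (fun q : S => w q) (fun y : U => (y : F (k + 1))) := by
    ext (q | y)
    · exact hS q
    · exact hU y
  -- The coefficients are coordinates in the basis, with a = 0 outside S. The b's lie in 𝔪 because w
  -- q agrees modulo 𝔪 with an element of the span of w '' S, whose U-coordinates vanish.
  refine ⟨S, U, fun q r => if h : r ∈ S then B.repr (w q) (Sum.inl ⟨r, h⟩) else 0,
    fun q y => if h : y ∈ U then B.repr (w q) (Sum.inr ⟨y, h⟩) else 0, ?_, ?_, ?_, ?_, ?_⟩
  · rw [← hB]; exact B.linearIndependent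
  · rw [← B.span_eq, hB, Set.Sum.elim_range, Set.image_eq_range]
    congr 2
    exact Subtype.range_coe.symm
  · intro q _
    conv_lhs => rw [← B.sum_repr (w q), Fintype.sum_sum_type]
    congr 1
    · refine Fintype.sum_of_injective Subtype.val Subtype.val_injective _ _ (fun r hr => ?_)
        fun r => ?_
      · rw [dif_neg (by simpa using hr), zero_smul]
      · rw [hS, dif_pos r.2]
    · rw [← Finset.sum_coe_sort U]
      refine Finset.sum_congr rfl fun y _ => ?_
      rw [hU, dif_pos y.2]
  · intro q _ r hr
    rw [dif_neg hr]
    exact zero_mem _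
  · intro q _ y hy
    rw [dif_pos hy]
    obtain ⟨m, hmS, hmq⟩ := hm q
    have h0 : B.coord (Sum.inr ⟨y, hy⟩) m = 0 := by
      suffices h : Submodule.span R (w '' S) ≤ LinearMap.ker (B.coord (Sum.inr ⟨y, hy⟩)) from h hmS
      rw [Submodule.span_le]
      rintro _ ⟨r, hr, rfl⟩
      rw [← hS ⟨r, hr⟩]
      simp
    have h1 := linearMap_mem_of_mem_smul_top _ (B.coord (Sum.inr ⟨y, hy⟩)) hmq
    rwa [map_sub, h0, sub_zero] at h1

end Reduction

/-! ### A basis of F_n ⊗ K_{n-1} sent exactly to the v_(λ,i). -/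

section SignedBasis

variable {R : Type u} [CommRing R] {k : ℕ}
  {F : ℕ → Type u} [∀ p, AddCommGroup (F p)] [∀ p, Module R (F p)]
  {x : Fin (k + 2) → R} {φ : ∀ p, F (p + 1) →ₗ[R] F p}
  {Λ : Type*} {v : Module.Basis Λ R (F (k + 2))} {w : Λ × Fin (k + 2) → F (k + 1)}
  {σ : ∀ p, TensorK R k F p →ₗ[R] F p}

/-- The basis `(-1)^i v_λ ⊗ ě_i` (for `i` counted from `1`) of `F_n ⊗ K_{n-1}`. -/
noncomputable def signedBasis (v : Module.Basis Λ R (F (k + 2))) :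
    Module.Basis (Λ × Fin (k + 2)) R (TensorK R k F (k + 1)) :=
  (v.tensorProduct (Finsupp.basisSingleOne.reindex (coSingletonEquiv (k + 1)).symm)).unitsSMul
    fun r => (-1) ^ ((r.2 : ℕ) + 1)

lemma signedBasis_apply (v : Module.Basis Λ R (F (k + 2))) (r : Λ × Fin (k + 2)) :
    signedBasis v r = (-1 : R) ^ ((r.2 : ℕ) + 1) • (v r.1 ⊗ₜ[R] koszulE R (coSingleton r.2)) := by
  rw [signedBasis, Module.Basis.unitsSMul_apply, Module.Basis.tensorProduct_apply,
    Module.Basis.reindex_apply, Finsupp.coe_basisSingleOne, Equiv.symm_symm, Units.smul_def]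
  simp [coSingletonEquiv, koszulE]

/-- The component of the boundary map of the mapping cone from `F_n ⊗ K_{n-1}` to `F_{n-1}`. -/
noncomputable def signedσ (σ : ∀ p, TensorK R k F p →ₗ[R] F p) :
    TensorK R k F (k + 1) →ₗ[R] F (k + 1) := (-1 : R) ^ (k + 1) • σ (k + 1)

lemma IsComparison.signedσ_signedBasis (hσ : IsComparison x φ v w σ) (r : Λ × Fin (k + 2)) :
    signedσ σ (signedBasis v r) = w r := by
  rw [signedσ, LinearMap.smul_apply, signedBasis_apply, map_smul, hσ.sub_top, smul_smul, smul_smul,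
    ← pow_add, ← pow_add, Even.neg_one_pow, one_smul]
  exact ⟨k + 2 + r.2, by ring⟩

end SignedBasis

/-! ### The two modified terms, in degrees n - 1 and n. -/

section Star

variable {R : Type u} [CommRing R] {k : ℕ}
  {F : ℕ → Type u} [∀ p, AddCommGroup (F p)] [∀ p, Module R (F p)]
  {x : Fin (k + 2) → R} {φ : ∀ p, F (p + 1) →ₗ[R] F p}
  {Λ : Type*} [Fintype Λ] {v : Module.Basis Λ R (F (k + 2))} {w : Λ × Fin (k + 2) → F (k + 1)}
  {σ : ∀ p, TensorK R k F p →ₗ[R] F p} {S : Set (Λ × Fin (k + 2))} {U : Finset (F (k + 1))}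
  {a : Λ × Fin (k + 2) → Λ × Fin (k + 2) → R} {b : Λ × Fin (k + 2) → F (k + 1) → R}

lemma starF_of_le {p : ℕ} (hp : p ≤ k) : starF v S U a p = ⊤ := by
  rw [starF, Function.update_of_ne (by omega), Function.update_of_ne (by omega), if_pos hp]

lemma starF_sub_top :
    starF v S U a (k + 1) = Submodule.span R (Set.range (subTopGen v U)) := by
  rw [starF, Function.update_of_ne (by omega), Function.update_self]

lemma starF_top : starF v S U a (k + 2) = Submodule.span R (Set.range (topGen v S a)) := by
  rw [starF, Function.update_self]

lemma starF_of_lt {p : ℕ} (hp : k + 2 < p) : starF v S U a p = ⊥ := by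
  rw [starF, Function.update_of_ne (by omega), Function.update_of_ne (by omega),
    if_neg (by omega)]

/-- In the signed basis *v_q lifts w_q - ∑ a w_r, so its image in F_{n-1} is the U-part of the
expansion of w_q. -/
lemma starV_eq (v : Module.Basis Λ R (F (k + 2))) (a : Λ × Fin (k + 2) → Λ × Fin (k + 2) → R)
    (q : Λ × Fin (k + 2)) :
    starV v a q = signedBasis v q - ∑ r, a q r • signedBasis v r := by
  rw [starV, sub_eq_add_neg, ← Finset.sum_neg_distrib]
  simp only [signedBasis_apply]
  congr 1
  refine Finset.sum_congr rfl fun r _ => ?_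
  rw [smul_smul, ← neg_smul]
  congr 1
  rw [pow_succ]
  ring

lemma IsComparison.signedσ_starV [IsLocalRing R] (hσ : IsComparison x φ v w σ)
    (hr : IsReduction w S U a b) {q : Λ × Fin (k + 2)} (hq : q ∉ S) :
    signedσ σ (starV v a q) = ∑ y ∈ U, b q y • y := by
  rw [starV_eq, map_sub, map_sum, hσ.signedσ_signedBasis]
  simp only [map_smul, hσ.signedσ_signedBasis]
  rw [sub_eq_iff_eq_add', ← hr.expand q hq]

open Classical in
/-- The elements `*v_q`, `q ∉ S`, form a basis of `F_n ⊗ K_{n-1}` together with the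
`(-1)^i v_λ ⊗ ě_i`, `(λ, i) ∈ S`. -/
lemma IsReduction.exists_basis [IsLocalRing R] (hr : IsReduction w S U a b)
    (v : Module.Basis Λ R (F (k + 2))) :
    ∃ B : Module.Basis (Λ × Fin (k + 2)) R (TensorK R k F (k + 1)),
      ∀ q, B q = if q ∈ S then signedBasis v q else starV v a q := by
  let g := signedBasis v
  let c (q : Λ × Fin (k + 2)) : TensorK R k F (k + 1) := if q ∈ S then g q else starV v a q
  have hfin : Module.Finite R (TensorK R k F (k + 1)) := Module.Finite.of_basis g
  have hspan : (⊤ : Submodule R (TensorK R k F (k + 1))) ≤ Submodule.span R (Set.range c) := by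
    -- Nakayama: for q ∉ S, replacing *v_q by its signed basis element changes it by terms indexed
    -- by S and by terms with coefficients in 𝔪.
    refine Submodule.le_of_le_smul_of_le_jacobson_bot Module.Finite.fg_top
      (IsLocalRing.maximalIdeal_le_jacobson ⊥) ?_
    have hS : ∀ q ∈ S, g q ∈ Submodule.span R (Set.range c) := fun q hq =>
      Submodule.subset_span ⟨q, if_pos hq⟩
    rw [← g.span_eq, Submodule.span_le, g.span_eq]
    rintro _ ⟨q, rfl⟩
    by_cases hq : q ∈ S
    · exact Submodule.mem_sup_left (hS q hq)
    · have h1 : g q = starV v a q + ∑ r, a q r • g r := by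
        rw [starV_eq, sub_add_cancel]
      rw [h1]
      refine add_mem (Submodule.mem_sup_left (Submodule.subset_span ⟨q, if_neg hq⟩))
        (Submodule.sum_mem _ fun r _ => ?_)
      by_cases hrS : r ∈ S
      · exact Submodule.mem_sup_left (Submodule.smul_mem _ _ (hS r hrS))
      · exact Submodule.mem_sup_right (Submodule.smul_mem_smul (hr.a_mem q hq r hrS) trivial)
  let ψ := g.constr R c
  have hsurj : Function.Surjective ψ := by
    rw [← LinearMap.range_eq_top, g.constr_range, ← top_le_iff]
    exact hspan
  have hbij : Function.Bijective ψ :=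
    ⟨OrzechProperty.injective_of_surjective_endomorphism ψ hsurj, hsurj⟩
  exact ⟨g.map (LinearEquiv.ofBijective ψ hbij), fun q => g.constr_basis R c q⟩

/-- The span of the `*v_q`, as a submodule of `F_n ⊗ K_{n-1}`. -/
noncomputable def starSpan (v : Module.Basis Λ R (F (k + 2))) (S : Set (Λ × Fin (k + 2)))
    (a : Λ × Fin (k + 2) → Λ × Fin (k + 2) → R) : Submodule R (TensorK R k F (k + 1)) :=
  Submodule.span R (Set.range fun q : (Sᶜ : Set (Λ × Fin (k + 2))) => starV v a q)

lemma map_mem_smul_span [IsLocalRing R] (hσ : IsComparison x φ v w σ)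
    (hr : IsReduction w S U a b) {ξ : TensorK R k F (k + 1)} (hξ : ξ ∈ starSpan v S a) :
    signedσ σ ξ ∈ IsLocalRing.maximalIdeal R • Submodule.span R (U : Set (F (k + 1))) := by
  suffices h : starSpan v S a ≤ (IsLocalRing.maximalIdeal R •
      Submodule.span R (U : Set (F (k + 1)))).comap (signedσ σ) from h hξ
  rw [starSpan, Submodule.span_le]
  rintro _ ⟨q, rfl⟩
  rw [SetLike.mem_coe, Submodule.mem_comap, hσ.signedσ_starV hr q.2]
  exact Submodule.sum_mem _ fun y hy =>
    Submodule.smul_mem_smul (hr.b_mem q q.2 y hy) (Submodule.subset_span hy)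

/-- F_n ⊗ K_{n-1} splits as the span of the *v plus a part with basis indexed by S. The former maps
into the span of U; the latter maps isomorphically onto the span of the w_q, q ∈ S, which meets the
span of U only in 0. -/
lemma mem_starSpan_iff [IsLocalRing R] (hσ : IsComparison x φ v w σ)
    (hr : IsReduction w S U a b) (ξ : TensorK R k F (k + 1)) :
    ξ ∈ starSpan v S a ↔ signedσ σ ξ ∈ Submodule.span R (U : Set (F (k + 1))) := by
  classical
  refine ⟨fun h => Submodule.smul_le_right (map_mem_smul_span hσ hr h), fun h => ?_⟩
  obtain ⟨B, hB⟩ := hr.exists_basis v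
  have hξ : ∀ q, B.repr ξ q • B q = (if q ∈ S then B.repr ξ q • signedBasis v q else 0) +
      (if q ∈ S then 0 else B.repr ξ q • starV v a q) := by
    intro q
    rw [hB]
    split_ifs <;> simp
  have hsum : ξ = ∑ q, (if q ∈ S then B.repr ξ q • signedBasis v q else 0) +
      ∑ q, (if q ∈ S then 0 else B.repr ξ q • starV v a q) := by
    rw [← Finset.sum_add_distrib, ← Finset.sum_congr rfl fun q _ => hξ q, B.sum_repr]
  have h2 : ∑ q, (if q ∈ S then 0 else B.repr ξ q • starV v a q) ∈ starSpan v S a := by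
    refine Submodule.sum_mem _ fun q _ => ?_
    split_ifs with hq
    · exact zero_mem _
    · exact Submodule.smul_mem _ _ (Submodule.subset_span ⟨⟨q, hq⟩, rfl⟩)
  have h3 : ∑ q, (if q ∈ S then B.repr ξ q • w q else 0) ∈
      Submodule.span R (U : Set (F (k + 1))) := by
    have h4 : signedσ σ (∑ q, (if q ∈ S then B.repr ξ q • signedBasis v q else 0)) =
        ∑ q, (if q ∈ S then B.repr ξ q • w q else 0) := by
      rw [map_sum]
      refine Finset.sum_congr rfl fun q _ => ?_
      split_ifs
      · rw [map_smul, hσ.signedσ_signedBasis]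
      · rw [map_zero]
    rw [← h4, ← Submodule.add_mem_iff_left _
      (Submodule.smul_le_right (map_mem_smul_span hσ hr h2)), ← map_add, ← hsum]
    exact h
  have hz : ∑ q, (if q ∈ S then B.repr ξ q • w q else 0) = 0 := by
    have hdisj := (hr.linearIndependent.disjoint_span_image
      (s := Set.range Sum.inl) (t := Set.range Sum.inr)
      Set.isCompl_range_inl_range_inr.disjoint)
    refine Submodule.disjoint_def.1 hdisj _ (Submodule.sum_mem _ fun q _ => ?_) ?_
    · split_ifs with hq
      · exact Submodule.smul_mem _ _ (Submodule.subset_span ⟨Sum.inl ⟨q, hq⟩, ⟨_, rfl⟩, rfl⟩)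
      · exact zero_mem _
    · refine Submodule.span_mono ?_ h3
      intro y hy
      exact ⟨Sum.inr ⟨y, hy⟩, ⟨_, rfl⟩, rfl⟩
  have hli : LinearIndependent R (fun q : S => w q) := by
    have := hr.linearIndependent.comp Sum.inl Sum.inl_injective
    exact this
  have hco : ∀ q ∈ S, B.repr ξ q = 0 := by
    have hz' : ∑ q : S, B.repr ξ q • w q = 0 := by
      rw [← hz]
      refine Fintype.sum_of_injective Subtype.val Subtype.val_injective _ _ (fun r hr => ?_)
        fun r => ?_
      · rw [if_neg (by simpa using hr)]
      · rw [if_pos r.2]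
    intro q hq
    exact Fintype.linearIndependent_iff.1 hli _ hz' ⟨q, hq⟩
  have h1 : ∑ q, (if q ∈ S then B.repr ξ q • signedBasis v q else 0) = 0 := by
    refine Finset.sum_eq_zero fun q _ => ?_
    split_ifs with hq
    · rw [hco q hq, zero_smul]
    · rfl
  rw [hsum, h1, zero_add]
  exact h2

lemma exists_sub_mem_span [IsLocalRing R] (hσ : IsComparison x φ v w σ)
    (hr : IsReduction w S U a b) (η : F (k + 1)) :
    ∃ ζ, η - signedσ σ ζ ∈ Submodule.span R (U : Set (F (k + 1))) := by
  have h : η ∈ Submodule.span R (w '' S) ⊔ Submodule.span R (U : Set (F (k + 1))) := by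
    rw [← Submodule.span_union, hr.span_eq_top]; trivial
  obtain ⟨y, hy, u, hu, rfl⟩ := Submodule.mem_sup.1 h
  suffices h' : Submodule.span R (w '' S) ≤ LinearMap.range (signedσ σ) by
    obtain ⟨ζ, rfl⟩ := h' hy
    exact ⟨ζ, by rwa [add_sub_cancel_left]⟩
  rw [Submodule.span_le]
  rintro _ ⟨r, -, rfl⟩
  exact ⟨_, hσ.signedσ_signedBasis r⟩

lemma linearIndependent_subTopGen [IsLocalRing R] (hr : IsReduction w S U a b)
    (v : Module.Basis Λ R (F (k + 2))) : LinearIndependent R (subTopGen v U) := by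
  have h := linearIndependent_inl_union_inr' (v.tensorProduct
    (Finsupp.basisSingleOne (R := R) (ι := Set.powersetCard (Fin (k + 2)) k))).linearIndependent
    (hr.linearIndependent.comp Sum.inr Sum.inr_injective)
  convert h using 1
  ext1 (t | y)
  · rw [Sum.elim_inl, Function.comp_apply, Module.Basis.tensorProduct_apply']
    rfl
  · rfl

lemma linearIndependent_topGen [IsLocalRing R] (hr : IsReduction w S U a b)
    (v : Module.Basis Λ R (F (k + 2))) : LinearIndependent R (topGen v S a) := by
  obtain ⟨B, hB⟩ := hr.exists_basis v
  have h := (B.linearIndependent.comp (Subtype.val : (Sᶜ : Set (Λ × Fin (k + 2))) → _)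
    Subtype.val_injective).map' (LinearMap.inl R _ (F (k + 2)))
    (LinearMap.ker_eq_bot.2 LinearMap.inl_injective)
  have hB' : topGen v S a = LinearMap.inl R _ (F (k + 2)) ∘ B ∘ Subtype.val := by
    ext1 q
    rw [Function.comp_apply, Function.comp_apply, hB, if_neg q.2]
    rfl
  rw [hB']
  exact h

lemma mem_starF_sub_top {ξ : TensorK R k F k} {η : F (k + 1)} :
    ((ξ, η) : Cone (TensorK R k F) F (k + 1)) ∈ starF v S U a (k + 1) ↔
      η ∈ Submodule.span R (U : Set (F (k + 1))) := by
  rw [starF_sub_top]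
  constructor
  · intro h
    suffices h' : Submodule.span R (Set.range (subTopGen v U)) ≤
        (Submodule.span R (U : Set (F (k + 1)))).comap
          (LinearMap.snd R (TensorK R k F k) (F (k + 1))) from h' h
    rw [Submodule.span_le]
    rintro _ ⟨t | y, rfl⟩
    · exact Submodule.zero_mem (Submodule.span R (U : Set (F (k + 1))))
    · exact Submodule.subset_span y.2
  · intro h
    have h1 : (LinearMap.inl R (TensorK R k F k) (F (k + 1)) ξ : Cone (TensorK R k F) F (k + 1)) ∈
        Submodule.span R (Set.range (subTopGen v U)) := by
      let B := v.tensorProduct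
        (Finsupp.basisSingleOne (R := R) (ι := Set.powersetCard (Fin (k + 2)) k))
      suffices h' : (⊤ : Submodule R (TensorK R k F k)) ≤
          (Submodule.span R (Set.range (subTopGen v U))).comap
            (LinearMap.inl R (TensorK R k F k) (F (k + 1))) from h' trivial
      rw [← B.span_eq, Submodule.span_le]
      rintro _ ⟨t, rfl⟩
      refine Submodule.subset_span ⟨Sum.inl t, ?_⟩
      change (_, _) = (_, _)
      rw [Module.Basis.tensorProduct_apply']
      rfl
    have h2 : (LinearMap.inr R (TensorK R k F k) (F (k + 1)) η : Cone (TensorK R k F) F (k + 1)) ∈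
        Submodule.span R (Set.range (subTopGen v U)) := by
      suffices h' : Submodule.span R (U : Set (F (k + 1))) ≤
          (Submodule.span R (Set.range (subTopGen v U))).comap
            (LinearMap.inr R (TensorK R k F k) (F (k + 1))) from h' h
      rw [Submodule.span_le]
      exact fun y hy => Submodule.subset_span ⟨Sum.inr ⟨y, hy⟩, rfl⟩
    have h3 := add_mem h1 h2
    convert h3 using 1
    exact Prod.ext (add_zero ξ).symm (zero_add η).symm

lemma mem_starF_top {ξ : TensorK R k F (k + 1)} {η : F (k + 2)} :
    ((ξ, η) : Cone (TensorK R k F) F (k + 2)) ∈ starF v S U a (k + 2) ↔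
      ξ ∈ starSpan v S a ∧ η = 0 := by
  have h : starF v S U a (k + 2) = (starSpan v S a).map
      (LinearMap.inl R (TensorK R k F (k + 1)) (F (k + 2))) := by
    rw [starF_top, starSpan, Submodule.map_span, ← Set.range_comp]
    rfl
  rw [h, Submodule.mem_map]
  constructor
  · rintro ⟨ζ, hζ, h⟩
    have h1 : ζ = ξ := congrArg Prod.fst h
    have h2 : 0 = η := congrArg Prod.snd h
    exact ⟨h1 ▸ hζ, h2.symm⟩
  · rintro ⟨hξ, rfl⟩
    exact ⟨ξ, hξ, rfl⟩

end Star

/-! ### Acyclicity and minimality of the reduced complex. -/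

section Main

variable {R : Type u} [CommRing R] {k : ℕ}
  {F : ℕ → Type u} [∀ p, AddCommGroup (F p)] [∀ p, Module R (F p)]
  {x : Fin (k + 2) → R} {φ : ∀ p, F (p + 1) →ₗ[R] F p}
  {Λ : Type*} {v : Module.Basis Λ R (F (k + 2))} {w : Λ × Fin (k + 2) → F (k + 1)}
  {σ : ∀ p, TensorK R k F p →ₗ[R] F p} {S : Set (Λ × Fin (k + 2))} {U : Finset (F (k + 1))}
  {a : Λ × Fin (k + 2) → Λ × Fin (k + 2) → R} {b : Λ × Fin (k + 2) → F (k + 1) → R}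

lemma tensorD_tensorD (x : Fin (k + 2) → R) (p : ℕ) (c : TensorK R k F (p + 2)) :
    tensorD F x p (tensorD F x (p + 1) c) = 0 := by
  rw [tensorD, tensorD, ← LinearMap.comp_apply, ← LinearMap.lTensor_comp, koszulD_comp_koszulD,
    LinearMap.lTensor_zero, LinearMap.zero_apply]

lemma tensorD_mem (x : Fin (k + 2) → R) {p : ℕ} (c : TensorK R k F (p + 1)) :
    tensorD F x p c ∈ Ideal.span (Set.range x) • (⊤ : Submodule R (TensorK R k F p)) := by
  induction c using TensorProduct.induction_on with
  | zero => rw [map_zero]; exact zero_mem _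
  | add c d hc hd => rw [map_add]; exact add_mem hc hd
  | tmul f c =>
    have h := Submodule.mem_map_of_mem (f := TensorProduct.mk R (F (k + 2)) _ f) (koszulD_mem x c)
    rw [Submodule.map_smul''] at h
    exact Submodule.smul_mono le_rfl le_top h

lemma span_le_maximalIdeal [IsLocalRing R] {n : ℕ} {x : Fin n → R}
    (hx : IsSystemOfParameters x) : Ideal.span (Set.range x) ≤ IsLocalRing.maximalIdeal R :=
  hx.radical_eq ▸ Ideal.le_radical

lemma IsComparison.coneD_coneD (hF : IsAcyclicFreeComplex (k + 2) F φ)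
    (hσ : IsComparison x φ v w σ) (p : ℕ) (c : Cone (TensorK R k F) F (p + 2)) :
    coneD (tensorD F x) φ σ p (coneD (tensorD F x) φ σ (p + 1) c) = 0 :=
  StarTransform.coneD_coneD (tensorD_tensorD x) (fun p c => (hF.exact p).apply_apply_eq_zero c)
    (fun p c => LinearMap.congr_fun (hσ.comm p) c) p c

/-- The mapping cone of `σ` is acyclic. -/
lemma IsComparison.exists_coneD_eq [IsLocalRing R] (hR : IsCohenMacaulayLocal R)
    (hx : IsSystemOfParameters x) (hF : IsAcyclicFreeComplex (k + 2) F φ)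
    (hσ : IsComparison x φ v w σ) (p : ℕ) (c : Cone (TensorK R k F) F (p + 1))
    (hc : coneD (tensorD F x) φ σ p c = 0) :
    ∃ c' : Cone (TensorK R k F) F (p + 2), coneD (tensorD F x) φ σ (p + 1) c' = c := by
  obtain ⟨ξ, η⟩ := c
  have hξ : ∃ ζ, tensorD F x p ζ = ξ := by
    cases p with
    | zero =>
      refine hσ.mem_range_of_map_mem hF ⟨-η, ?_⟩
      rw [coneD_zero_apply] at hc
      rw [map_neg, neg_eq_iff_add_eq_zero, add_comm]
      exact hc
    | succ p =>
      have := hF.free (k + 2)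
      rw [coneD_succ_apply] at hc
      exact (koszul_tensor_exact hR hx (F (k + 2)) p ξ).1 (congrArg Prod.fst hc)
  obtain ⟨ζ, hζ⟩ := hξ
  obtain ⟨η', h⟩ := StarTransform.exists_coneD_eq hF.exact
    (fun p c => LinearMap.congr_fun (hσ.comm p) c) p hc hζ
  exact ⟨_, h⟩

/-- With `IsComparison.eq_zero_of_top`, this says that F_n ⊗ K_n → F_n is bijective, so these two
terms of the cone cancel. -/
lemma IsComparison.exists_signed_eq (hσ : IsComparison x φ v w σ) (η : F (k + 2)) :
    ∃ ζ, (-1 : R) ^ (k + 2) • σ (k + 2) ζ = η :=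
  ⟨η ⊗ₜ koszulE R (fullSet (k + 2)), by
    rw [hσ.top_tmul, smul_smul, ← mul_pow, neg_one_mul, neg_neg, one_pow, one_smul]⟩

lemma IsComparison.eq_zero_of_top (hσ : IsComparison x φ v w σ) {ζ : TensorK R k F (k + 2)}
    (h : (-1 : R) ^ (k + 2) • σ (k + 2) ζ = 0) : ζ = 0 := by
  obtain ⟨f, rfl⟩ := IsComparison.exists_eq_tmul eq_fullSet ζ
  rw [hσ.top_tmul, smul_smul, ← mul_pow, neg_one_mul, neg_neg, one_pow, one_smul] at h
  rw [h, TensorProduct.zero_tmul]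

variable [Fintype Λ]

lemma coneD_top_apply (ξ : TensorK R k F (k + 1)) (η : F (k + 2)) :
    coneD (tensorD F x) φ σ (k + 1) (ξ, η) = (tensorD F x k ξ, signedσ σ ξ + φ (k + 1) η) := rfl

/-- Up to boundaries, every element of the mapping cone of degree `≤ n - 1` lies in `*F`. -/
lemma IsComparison.exists_mem_starF [IsLocalRing R] (hF : IsAcyclicFreeComplex (k + 2) F φ)
    (hσ : IsComparison x φ v w σ) (hr : IsReduction w S U a b) {p : ℕ} (hp : p ≤ k)
    (c : Cone (TensorK R k F) F (p + 1)) :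
    ∃ c' ∈ starF v S U a (p + 1), coneD (tensorD F x) φ σ p c' = coneD (tensorD F x) φ σ p c := by
  obtain hp | rfl := hp.lt_or_eq
  · exact ⟨c, by rw [starF_of_le (by omega)]; trivial, rfl⟩
  · obtain ⟨ξ, η⟩ := c
    obtain ⟨ζ, hζ⟩ := exists_sub_mem_span hσ hr η
    refine ⟨(ξ, η) - coneD (tensorD F x) φ σ (p + 1) (ζ, 0), ?_, ?_⟩
    · rw [coneD_top_apply, map_zero, add_zero]
      exact mem_starF_sub_top.2 hζ
    · rw [map_sub, hσ.coneD_coneD hF, sub_zero]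

lemma IsComparison.coneD_mem_starF [IsLocalRing R] (hσ : IsComparison x φ v w σ)
    (hr : IsReduction w S U a b) (p : ℕ) (c : Cone (TensorK R k F) F (p + 1))
    (hc : c ∈ starF v S U a (p + 1)) : coneD (tensorD F x) φ σ p c ∈ starF v S U a p := by
  obtain hp | hp := le_or_gt p k
  · rw [starF_of_le hp]; trivial
  obtain rfl | hp : p = k + 1 ∨ k + 1 < p := by omega
  · obtain ⟨ξ, η⟩ := c
    obtain ⟨hξ, rfl⟩ := mem_starF_top.1 hc
    rw [coneD_top_apply, map_zero, add_zero]
    exact mem_starF_sub_top.2 ((mem_starSpan_iff hσ hr ξ).1 hξ)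
  · rw [starF_of_lt (Nat.succ_lt_succ hp), Submodule.mem_bot] at hc
    rw [hc, map_zero]
    exact zero_mem _

lemma IsComparison.starF_exact [IsLocalRing R] (hR : IsCohenMacaulayLocal R)
    (hx : IsSystemOfParameters x) (hF : IsAcyclicFreeComplex (k + 2) F φ)
    (hσ : IsComparison x φ v w σ) (hr : IsReduction w S U a b) (p : ℕ)
    (c : Cone (TensorK R k F) F (p + 1)) (hc : c ∈ starF v S U a (p + 1))
    (h0 : coneD (tensorD F x) φ σ p c = 0) :
    ∃ c' ∈ starF v S U a (p + 2), coneD (tensorD F x) φ σ (p + 1) c' = c := by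
  obtain ⟨c', hc'⟩ := hσ.exists_coneD_eq hR hx hF p c h0
  obtain hp | hp := lt_or_ge p k
  · obtain ⟨d, hd, hdc⟩ := hσ.exists_mem_starF hF hr (Nat.succ_le_of_lt hp) c'
    exact ⟨d, hd, hdc.trans hc'⟩
  obtain rfl | hp := hp.eq_or_lt
  · obtain ⟨ξ, η⟩ := c'
    -- Subtracting the boundary of (ζ, 0) removes the F_n-coordinate of the preimage. What remains
    -- lies in *F_n because its boundary has second coordinate in the span of U.
    obtain ⟨ζ, rfl⟩ := hσ.exists_signed_eq η
    have h1 := hσ.coneD_coneD hF (k + 1) (ζ, 0)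
    rw [coneD_succ_apply (k + 1), map_zero, add_zero] at h1
    have h2 : coneD (tensorD F x) φ σ (k + 1) (ξ - tensorD F x (k + 1) ζ, 0) = c := by
      rw [← hc', ← sub_zero (coneD (tensorD F x) φ σ (k + 1) (ξ, _)), ← h1, ← map_sub]
      congr 1
      exact Prod.ext rfl (sub_self _).symm
    refine ⟨(ξ - tensorD F x (k + 1) ζ, 0), mem_starF_top.2 ⟨?_, rfl⟩, h2⟩
    rw [mem_starSpan_iff hσ hr]
    rw [← h2, coneD_top_apply, map_zero, add_zero] at hc
    exact mem_starF_sub_top.1 hc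
  -- From here on c itself must vanish. In degree n its preimage in the cone lies in F_n ⊗ K_n,
  -- which injects into the F_n-coordinate, and that coordinate of c is 0.
  refine ⟨0, zero_mem _, ?_⟩
  rw [map_zero]
  obtain rfl | hp : p = k + 1 ∨ k + 1 < p := by omega
  · obtain ⟨ζ, η⟩ := c'
    have := hF.length (k + 3) (by omega)
    obtain rfl : η = 0 := Subsingleton.elim (α := F (k + 3)) _ _
    obtain ⟨ξ, η⟩ := c
    obtain ⟨-, rfl⟩ := mem_starF_top.1 hc
    rw [coneD_succ_apply, map_zero, add_zero] at hc'
    rw [hσ.eq_zero_of_top (congrArg Prod.snd hc')] at hc'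
    rw [← hc', map_zero, map_zero, smul_zero]
    rfl
  · rw [starF_of_lt (Nat.succ_lt_succ hp), Submodule.mem_bot] at hc
    exact hc.symm

/-- The first coordinate lies in Q times its module because Koszul differentials have entries in Q ⊆
𝔪; the second lies in 𝔪 times the span of U because b ∈ 𝔪. -/
lemma IsComparison.coneD_mem_smul_starF [IsLocalRing R]
    (hx : IsSystemOfParameters x)
    (hσ : IsComparison x φ v w σ) (hr : IsReduction w S U a b)
    (c : Cone (TensorK R k F) F (k + 2)) (hc : c ∈ starF v S U a (k + 2)) :
    coneD (tensorD F x) φ σ (k + 1) c ∈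
      IsLocalRing.maximalIdeal R • starF v S U a (k + 1) := by
  obtain ⟨ξ, η⟩ := c
  obtain ⟨hξ, rfl⟩ := mem_starF_top.1 hc
  rw [coneD_top_apply, map_zero, add_zero]
  have h1 := Submodule.mem_map_of_mem (f := LinearMap.inl R (TensorK R k F k) (F (k + 1)))
    (Submodule.smul_mono (span_le_maximalIdeal hx) le_rfl (tensorD_mem x ξ))
  have h2 := Submodule.mem_map_of_mem (f := LinearMap.inr R (TensorK R k F k) (F (k + 1)))
    (map_mem_smul_span hσ hr hξ)
  rw [Submodule.map_smul''] at h1 h2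
  have h3 : Submodule.map (LinearMap.inl R (TensorK R k F k) (F (k + 1))) ⊤ ≤
      starF v S U a (k + 1) := by
    rintro _ ⟨ζ, -, rfl⟩
    exact mem_starF_sub_top.2 (zero_mem _)
  have h4 : Submodule.map (LinearMap.inr R (TensorK R k F k) (F (k + 1)))
      (Submodule.span R (U : Set (F (k + 1)))) ≤ starF v S U a (k + 1) := by
    rintro _ ⟨ζ, hζ, rfl⟩
    exact mem_starF_sub_top.2 hζ
  have h5 := add_mem (Submodule.smul_mono le_rfl h3 h1) (Submodule.smul_mono le_rfl h4 h2)
  convert h5 using 1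
  exact Prod.ext (add_zero _).symm (zero_add _).symm

lemma exists_basis_of_eq_span {A ι : Type*} [AddCommGroup A] [Module R A] {g : ι → A}
    (hg : LinearIndependent R g) {N : Submodule R A} (hN : N = Submodule.span R (Set.range g)) :
    ∃ B : Module.Basis ι R N, ∀ i, (B i : A) = g i := by
  subst hN
  exact ⟨Module.Basis.span hg, fun i => by rw [Module.Basis.span_apply]⟩

lemma isAcyclicFreeComplex_starF [IsLocalRing R] (hR : IsCohenMacaulayLocal R)
    (hx : IsSystemOfParameters x) (hF : IsAcyclicFreeComplex (k + 2) F φ)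
    (hσ : IsComparison x φ v w σ) (hr : IsReduction w S U a b)
    (h : ∀ p, ∀ c ∈ starF v S U a (p + 1), coneD (tensorD F x) φ σ p c ∈ starF v S U a p) :
    IsAcyclicFreeComplex (k + 2) (fun p => starF v S U a p) (starD x φ v σ S U a h) := by
  obtain ⟨B₁, -⟩ := exists_basis_of_eq_span (linearIndependent_topGen hr v) starF_top
  obtain ⟨B₂, -⟩ := exists_basis_of_eq_span (linearIndependent_subTopGen hr v)
    (starF_sub_top (v := v) (S := S) (U := U) (a := a))
  have hfree : ∀ p, p ≤ k → Module.Free R (starF v S U a p) ∧ Module.Finite R (starF v S U a p) := by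
    intro p hp
    rw [starF_of_le hp]
    have := hF.free
    have := hF.finite
    cases p with
    | zero => exact ⟨Module.Free.of_equiv (Submodule.topEquiv (R := R) (M := F 0)).symm,
        Module.Finite.equiv (Submodule.topEquiv (R := R) (M := F 0)).symm⟩
    | succ p => exact ⟨Module.Free.of_equiv
          (Submodule.topEquiv (R := R) (M := TensorK R k F p × F (p + 1))).symm,
        Module.Finite.equiv (Submodule.topEquiv (R := R) (M := TensorK R k F p × F (p + 1))).symm⟩
  have hlen : ∀ p, k + 2 < p → Subsingleton (starF v S U a p) := by
    intro p hp
    rw [starF_of_lt hp]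
    infer_instance
  have hcases : ∀ p, p ≤ k ∨ p = k + 1 ∨ p = k + 2 ∨ k + 2 < p := by omega
  refine ⟨fun p => ?_, fun p => ?_, hlen, fun p => ?_⟩
  · obtain hp | rfl | rfl | hp := hcases p
    · exact (hfree p hp).2
    · exact Module.Finite.of_basis B₂
    · have : Finite (Sᶜ : Set (Λ × Fin (k + 2))) := inferInstance
      exact Module.Finite.of_basis B₁
    · have := hlen p hp
      infer_instance
  · obtain hp | rfl | rfl | hp := hcases p
    · exact (hfree p hp).1
    · exact Module.Free.of_basis B₂
    · exact Module.Free.of_basis B₁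
    · have := hlen p hp
      infer_instance
  · rintro ⟨c, hc⟩
    constructor
    · intro h0
      obtain ⟨c', hc', h1⟩ := hσ.starF_exact hR hx hF hr p c hc (congrArg Subtype.val h0)
      exact ⟨⟨c', hc'⟩, Subtype.ext h1⟩
    · rintro ⟨⟨c', hc'⟩, h1⟩
      rw [← h1]
      exact Subtype.ext (hσ.coneD_coneD hF p c')

end Main
end StarTransform

/-! ### The main theorem. -/

open StarTransform in
theorem theorem3p6 {R : Type u} [CommRing R] [IsLocalRing R] (hR : IsCohenMacaulayLocal R)
    (k : ℕ) (x : Fin (k + 2) → R) (hx : IsSystemOfParameters x)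
    (F : ℕ → Type u) [∀ p, AddCommGroup (F p)] [∀ p, Module R (F p)]
    (φ : ∀ p, F (p + 1) →ₗ[R] F p) (hF : IsAcyclicFreeComplex (k + 2) F φ)
    (hφ : LinearMap.range (φ (k + 1)) ≤ Ideal.span (Set.range x) • (⊤ : Submodule R (F (k + 1))))
    {Λ : Type*} [Fintype Λ] (v : Module.Basis Λ R (F (k + 2)))
    (w : Λ × Fin (k + 2) → F (k + 1)) (hw : ∀ l, φ (k + 1) (v l) = ∑ i, x i • w (l, i)) :
    (∃ σ : ∀ p, TensorK R k F p →ₗ[R] F p, IsComparison x φ v w σ) ∧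
    (∃ (S : Set (Λ × Fin (k + 2))) (U : Finset (F (k + 1)))
      (a : Λ × Fin (k + 2) → Λ × Fin (k + 2) → R) (b : Λ × Fin (k + 2) → F (k + 1) → R),
      IsReduction w S U a b) ∧
    ∀ (σ : ∀ p, TensorK R k F p →ₗ[R] F p), IsComparison x φ v w σ →
    ∀ (S : Set (Λ × Fin (k + 2))) (U : Finset (F (k + 1)))
      (a : Λ × Fin (k + 2) → Λ × Fin (k + 2) → R) (b : Λ × Fin (k + 2) → F (k + 1) → R),
      IsReduction w S U a b →
      ∃ h : ∀ p, ∀ c ∈ starF v S U a (p + 1), coneD (tensorD F x) φ σ p c ∈ starF v S U a p,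
        IsAcyclicFreeComplex (k + 2) (fun p => starF v S U a p) (starD x φ v σ S U a h) ∧
        starF v S U a 0 = ⊤ ∧
        (LinearMap.range (starD x φ v σ S U a h 0)).map (starF v S U a 0).subtype =
          moduleColon (LinearMap.range (φ 0)) (Ideal.span (Set.range x)) ∧
        LinearMap.range (starD x φ v σ S U a h (k + 1)) ≤
          IsLocalRing.maximalIdeal R • (⊤ : Submodule R (starF v S U a (k + 1))) ∧
        (∃ B : Module.Basis (Sᶜ : Set (Λ × Fin (k + 2))) R (starF v S U a (k + 2)),
          ∀ q, (B q : Cone (TensorK R k F) F (k + 2)) = topGen v S a q) ∧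
        (∃ B : Module.Basis ((Λ × Set.powersetCard (Fin (k + 2)) k) ⊕ U) R
            (starF v S U a (k + 1)),
          ∀ t, (B t : Cone (TensorK R k F) F (k + 1)) = subTopGen v U t) := by
  have := hR.noetherian
  have := hF.free (k + 1)
  have := hF.finite (k + 1)
  refine ⟨exists_isComparison hR hx hF hw, exists_isReduction w, fun σ hσ S U a b hr => ?_⟩
  have h := hσ.coneD_mem_starF (S := S) (U := U) (a := a) hr
  refine ⟨h, isAcyclicFreeComplex_starF hR hx hF hσ hr h, starF_of_le (Nat.zero_le k), ?_, ?_,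
    exists_basis_of_eq_span (linearIndependent_topGen hr v) starF_top,
    exists_basis_of_eq_span (linearIndependent_subTopGen hr v) starF_sub_top⟩
  · ext z
    constructor
    · rintro ⟨_, ⟨⟨⟨ξ, η⟩, hc⟩, rfl⟩, rfl⟩
      refine add_mem (hσ.map_mem_colon ξ) fun q _ => ?_
      exact Submodule.smul_mem _ q ⟨η, rfl⟩
    · intro hz
      obtain ⟨ξ, η, rfl⟩ := hσ.exists_of_mem_colon hR hx hF hz
      -- For n = 2 the degree 1 term is already the reduced one, so (ξ, η) may have to be changed by
      -- a boundary.
      obtain ⟨c, hc, hc'⟩ := hσ.exists_mem_starF hF hr (Nat.zero_le k) (ξ, η)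
      exact ⟨_, ⟨⟨c, hc⟩, rfl⟩, hc'⟩
  · rintro _ ⟨⟨c, hc⟩, rfl⟩
    rw [Submodule.mem_smul_top_iff]
    exact hσ.coneD_mem_smul_starF hx hr c hc
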